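/- Let $F$ be an algebraically closed field of characteristic $p>2$ and let $n\ge 2$. Let $\mathfrak g=\mathfrak p(n)$ be the Lie superalgebra over $F$ of all block matrices $\begin{pmatrix}a&b\\c&-a^t\end{pmatrix}$ with $a,b,c$ of size $n\times n$, $b$ symmetric and $c$ skew-symmetric, with the supercommutator as bracket; its even part $\mathfrak g_{\bar 0}$ is given by $b=c=0$ and its odd part by $a=0$. Let $\mathfrak g_1\subseteq\mathfrak g$ be the subspace $a=c=0$ and let $\mathfrak g^+=\mathfrak g_{\bar 0}\oplus\mathfrak g_1$. Write $\tilde e_{ij}=e_{ij}-e_{j+n,i+n}\in\mathfrak g_{\bar 0}$ for $1\le i,j\le n$, let $\mathfrak n_0^+$ be the span of the $\tilde e_{ij}$ with $i<j$, and let $h_i=\tilde e_{ii}$. The $p$-mapping $x\mapsto x^{[p]}$ on $\mathfrak g_{\bar 0}$ is the $p$-th power of matrices. For $\chi\in\mathfrak g_{\bar 0}^*$ and $L$ one of $\mathfrak g,\mathfrak g^+,\mathfrak g_{\bar 0}$, let $u_\chi(L)$ be the quotient of the universal enveloping superalgebra $U(L)$ by the two-sided ideal generated by the elements $x^p-x^{[p]}-\chi(x)^p$,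 $x\in\mathfrak g_{\bar 0}$. Assume $\chi(\mathfrak n_0^+)=0$, and let $M$ be a simple $u_\chi(\mathfrak g_{\bar 0})$-module generated by a maximal vector of weight $\mu=(\mu_1,\dots,\mu_n)\in F^n$, that is, by a nonzero vector $v$ with $\mathfrak n_0^+v=0$ and $h_iv=\mu_iv$ for all $i$. View $M$ as a $u_\chi(\mathfrak g^+)$-module by letting $\mathfrak g_1$ act by zero, and let $K_\chi(M)=u_\chi(\mathfrak g)\otimes_{u_\chi(\mathfrak g^+)}M$ be the Kac module. If $$\delta_\mu=\prod_{1\le i<j\le n}(\mu_i-\mu_j+j-i-1)\ne 0\quad\text{in }F,$$ then $K_\chi(M)$ is a simple $u_\chi(\mathfrak g)$-module: it is nonzero and has no submodules, graded or not, other than $0$ and itself. -/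

import Mathlib

open scoped TensorProduct

noncomputable section

/-- A restricted Lie superalgebra sitting inside an associative algebra `A` over `F`: an even
part and an odd part (linear subspaces of `A`, with zero intersection) which are stable under the
supercommutator `[x, y] = x y - (-1)^{|x||y|} y x`, the even part being stable under
the `p`-th power map of `A`.  The super Jacobi identity and the laws of a `p`-mapping
are then inherited from `A`. -/
structure RestrictedLieSuperalgebra (F A : Type*) [CommRing F] [Ring A] [Algebra F A] (p : ℕ) where
  even : Submodule F A
  odd : Submodule F A
  disjoint : Disjoint even odd
  lie_even_even : ∀ x ∈ even, ∀ y ∈ even, x * y - y * x ∈ even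
  lie_even_odd : ∀ x ∈ even, ∀ y ∈ odd, x * y - y * x ∈ odd
  lie_odd_odd : ∀ x ∈ odd, ∀ y ∈ odd, x * y + y * x ∈ even
  pow_mem : ∀ x ∈ even, x ^ p ∈ even

namespace RestrictedLieSuperalgebra

section Enveloping

variable {F A : Type*} [CommRing F] [Ring A] [Algebra F A] {p : ℕ}
variable (L : RestrictedLieSuperalgebra F A p)

/-- The bracket of two even elements. -/
def lie₀₀ (x y : L.even) : L.even :=
  ⟨(x : A) * y - y * x, L.lie_even_even x x.2 y y.2⟩

/-- The bracket of an even and an odd element. -/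
def lie₀₁ (x : L.even) (y : L.odd) : L.odd :=
  ⟨(x : A) * y - y * x, L.lie_even_odd x x.2 y y.2⟩

/-- The (symmetric) bracket of two odd elements. -/
def lie₁₁ (x y : L.odd) : L.even :=
  ⟨(x : A) * y + y * x, L.lie_odd_odd x x.2 y y.2⟩

/-- The `p`-mapping `x ↦ x^[p]` on the even part: the `p`-th power in `A`. -/
def pMap (x : L.even) : L.even := ⟨(x : A) ^ p, L.pow_mem x x.2⟩

/-- The underlying vector space of the Lie superalgebra is the direct sum `even × odd`.
The relations `x y - (-1)^{|x||y|} y x = [x, y]`, for homogeneous `x` and `y`, in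
its tensor algebra. -/
inductive EnvRel : TensorAlgebra F (L.even × L.odd) → TensorAlgebra F (L.even × L.odd) → Prop
  | even_even (x y : L.even) :
      EnvRel
        (TensorAlgebra.ι F (x, 0) * TensorAlgebra.ι F (y, 0)
          - TensorAlgebra.ι F (y, 0) * TensorAlgebra.ι F (x, 0))
        (TensorAlgebra.ι F (L.lie₀₀ x y, 0))
  | even_odd (x : L.even) (y : L.odd) :
      EnvRel
        (TensorAlgebra.ι F (x, 0) * TensorAlgebra.ι F (0, y)
          - TensorAlgebra.ι F (0, y) * TensorAlgebra.ι F (x, 0))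
        (TensorAlgebra.ι F (0, L.lie₀₁ x y))
  | odd_odd (x y : L.odd) :
      EnvRel
        (TensorAlgebra.ι F (0, x) * TensorAlgebra.ι F (0, y)
          + TensorAlgebra.ι F (0, y) * TensorAlgebra.ι F (0, x))
        (TensorAlgebra.ι F (L.lie₁₁ x y, 0))

/-- The universal enveloping (super)algebra `U(L)`. -/
def Env : Type _ := RingQuot L.EnvRel

instance : Ring L.Env := inferInstanceAs (Ring (RingQuot L.EnvRel))

instance : Algebra F L.Env := inferInstanceAs (Algebra F (RingQuot L.EnvRel))

/-- The quotient map from the tensor algebra to `U(L)`. -/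
def mkEnv : TensorAlgebra F (L.even × L.odd) →ₐ[F] L.Env := RingQuot.mkAlgHom F L.EnvRel

/-- The canonical map from `L` to `U(L)`. -/
def envι : (L.even × L.odd) →ₗ[F] L.Env :=
  L.mkEnv.toLinearMap ∘ₗ TensorAlgebra.ι F

/-- The relations `x^p - x^[p] = χ(x)^p`, for `x` even, in `U(L)`. -/
inductive RedRel (χ : Module.Dual F L.even) : L.Env → L.Env → Prop
  | pow (x : L.even) :
      RedRel χ (L.envι (x, 0) ^ p - L.envι (L.pMap x, 0)) (algebraMap F L.Env (χ x ^ p))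

/-- The `χ`-reduced enveloping algebra `u_χ(L)`: the quotient of `U(L)` by the two-sided ideal
generated by the elements `x^p - x^[p] - χ(x)^p`, for `x` even. -/
def Red (χ : Module.Dual F L.even) : Type _ := RingQuot (L.RedRel χ)

variable (χ : Module.Dual F L.even)

instance : Ring (L.Red χ) := inferInstanceAs (Ring (RingQuot (L.RedRel χ)))

instance : Algebra F (L.Red χ) := inferInstanceAs (Algebra F (RingQuot (L.RedRel χ)))

/-- The quotient map from `U(L)` to `u_χ(L)`. -/
def mkRed : L.Env →ₐ[F] L.Red χ := RingQuot.mkAlgHom F (L.RedRel χ)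

/-- The canonical map from the even part of `L` to `u_χ(L)`. -/
def ι₀ : L.even →ₗ[F] L.Red χ :=
  (L.mkRed χ).toLinearMap ∘ₗ L.envι ∘ₗ LinearMap.inl F L.even L.odd

/-- The canonical map from the odd part of `L` to `u_χ(L)`. -/
def ι₁ : L.odd →ₗ[F] L.Red χ :=
  (L.mkRed χ).toLinearMap ∘ₗ L.envι ∘ₗ LinearMap.inr F L.even L.odd

theorem ι₀_mul_ι₀ (x y : L.even) :
    L.ι₀ χ x * L.ι₀ χ y - L.ι₀ χ y * L.ι₀ χ x = L.ι₀ χ (L.lie₀₀ x y) := by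
  have h : L.mkEnv _ = L.mkEnv _ := RingQuot.mkAlgHom_rel F (EnvRel.even_even (L := L) x y)
  simp only [map_sub, map_mul] at h
  simpa [ι₀, envι] using congrArg (L.mkRed χ) h

theorem ι₀_mul_ι₁ (x : L.even) (y : L.odd) :
    L.ι₀ χ x * L.ι₁ χ y - L.ι₁ χ y * L.ι₀ χ x = L.ι₁ χ (L.lie₀₁ x y) := by
  have h : L.mkEnv _ = L.mkEnv _ := RingQuot.mkAlgHom_rel F (EnvRel.even_odd (L := L) x y)
  simp only [map_sub, map_mul] at h
  simpa [ι₀, ι₁, envι] using congrArg (L.mkRed χ) h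

theorem ι₁_mul_ι₁ (x y : L.odd) :
    L.ι₁ χ x * L.ι₁ χ y + L.ι₁ χ y * L.ι₁ χ x = L.ι₀ χ (L.lie₁₁ x y) := by
  have h : L.mkEnv _ = L.mkEnv _ := RingQuot.mkAlgHom_rel F (EnvRel.odd_odd (L := L) x y)
  simp only [map_add, map_mul] at h
  simpa [ι₀, ι₁, envι] using congrArg (L.mkRed χ) h

theorem ι₀_pow (x : L.even) :
    L.ι₀ χ x ^ p - L.ι₀ χ (L.pMap x) = algebraMap F (L.Red χ) (χ x ^ p) := by
  have h : L.mkRed χ _ = L.mkRed χ _ := RingQuot.mkAlgHom_rel F (RedRel.pow (χ := χ) x)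
  simp only [map_sub, map_pow, AlgHom.commutes] at h
  simpa [ι₀] using h

/-- The universal property of `u_χ(L)`. -/
def lift {B : Type*} [Ring B] [Algebra F B] (f₀ : L.even →ₗ[F] B) (f₁ : L.odd →ₗ[F] B)
    (h₀₀ : ∀ x y, f₀ x * f₀ y - f₀ y * f₀ x = f₀ (L.lie₀₀ x y))
    (h₀₁ : ∀ x y, f₀ x * f₁ y - f₁ y * f₀ x = f₁ (L.lie₀₁ x y))
    (h₁₁ : ∀ x y, f₁ x * f₁ y + f₁ y * f₁ x = f₀ (L.lie₁₁ x y))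
    (hp : ∀ x, f₀ x ^ p - f₀ (L.pMap x) = algebraMap F B (χ x ^ p)) :
    L.Red χ →ₐ[F] B :=
  let φ : L.Env →ₐ[F] B :=
    RingQuot.liftAlgHom F ⟨TensorAlgebra.lift F (f₀.coprod f₁), by
      intro a b hab
      cases hab with
      | even_even x y => simpa using h₀₀ x y
      | even_odd x y => simpa using h₀₁ x y
      | odd_odd x y => simpa using h₁₁ x y⟩
  have hφ : ∀ z, φ (L.envι z) = f₀ z.1 + f₁ z.2 := fun z =>
    (RingQuot.liftAlgHom_mkAlgHom_apply F _ _ _).trans (by simp)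
  RingQuot.liftAlgHom F ⟨φ, by
    intro a b hab
    cases hab with
    | pow x => simpa [hφ] using hp x⟩

theorem lift_ι₀ {B : Type*} [Ring B] [Algebra F B] (f₀ : L.even →ₗ[F] B) (f₁ : L.odd →ₗ[F] B)
    (h₀₀ h₀₁ h₁₁ hp) (x : L.even) : L.lift χ f₀ f₁ h₀₀ h₀₁ h₁₁ hp (L.ι₀ χ x) = f₀ x :=
  (RingQuot.liftAlgHom_mkAlgHom_apply F _ _ _).trans
    ((RingQuot.liftAlgHom_mkAlgHom_apply F _ _ _).trans (by simp))

theorem lift_ι₁ {B : Type*} [Ring B] [Algebra F B] (f₀ : L.even →ₗ[F] B) (f₁ : L.odd →ₗ[F] B)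
    (h₀₀ h₀₁ h₁₁ hp) (x : L.odd) : L.lift χ f₀ f₁ h₀₀ h₀₁ h₁₁ hp (L.ι₁ χ x) = f₁ x :=
  (RingQuot.liftAlgHom_mkAlgHom_apply F _ _ _).trans
    ((RingQuot.liftAlgHom_mkAlgHom_apply F _ _ _).trans (by simp))

end Enveloping

end RestrictedLieSuperalgebra

namespace Periplectic

open Matrix RestrictedLieSuperalgebra

section Algebra

variable (F : Type*) [Field F] (n : ℕ)

/-- The `2n × 2n` matrices over `F`, in `n × n` blocks. -/
abbrev Mat : Type _ := Matrix (Fin n ⊕ Fin n) (Fin n ⊕ Fin n) F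

/-- The even part `𝔤₀` of `𝔭(n)`: the block matrices `(a, 0; 0, -aᵗ)`. -/
def g₀ : Submodule F (Mat F n) where
  carrier := {x | ∃ a : Matrix (Fin n) (Fin n) F, x = fromBlocks a 0 0 (-aᵀ)}
  add_mem' := by
    rintro _ _ ⟨a, rfl⟩ ⟨b, rfl⟩
    exact ⟨a + b, by simp [fromBlocks_add, add_comm]⟩
  zero_mem' := ⟨0, by simp⟩
  smul_mem' := by
    rintro c _ ⟨a, rfl⟩
    exact ⟨c • a, by simp [fromBlocks_smul]⟩

/-- The subspace `𝔤₁`: the block matrices `(0, b; 0, 0)` with `b` symmetric. -/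
def gPos : Submodule F (Mat F n) where
  carrier := {x | ∃ b : Matrix (Fin n) (Fin n) F, bᵀ = b ∧ x = fromBlocks 0 b 0 0}
  add_mem' := by
    rintro _ _ ⟨a, ha, rfl⟩ ⟨b, hb, rfl⟩
    exact ⟨a + b, by simp [ha, hb], by simp [fromBlocks_add]⟩
  zero_mem' := ⟨0, by simp⟩
  smul_mem' := by
    rintro c _ ⟨a, ha, rfl⟩
    exact ⟨c • a, by simp [ha], by simp [fromBlocks_smul]⟩

/-- The odd part `𝔤₋₁ ⊕ 𝔤₁` of `𝔭(n)`: the block matrices `(0, b; c, 0)` with `b` symmetric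
and `c` skew-symmetric. -/
def gOdd : Submodule F (Mat F n) where
  carrier := {x | ∃ b c : Matrix (Fin n) (Fin n) F, bᵀ = b ∧ cᵀ = -c ∧ x = fromBlocks 0 b c 0}
  add_mem' := by
    rintro _ _ ⟨b, c, hb, hc, rfl⟩ ⟨b', c', hb', hc', rfl⟩
    exact ⟨b + b', c + c', by simp [hb, hb'], by simp [hc, hc', add_comm],
      by simp [fromBlocks_add]⟩
  zero_mem' := ⟨0, 0, by simp⟩
  smul_mem' := by
    rintro r _ ⟨b, c, hb, hc, rfl⟩
    exact ⟨r • b, r • c, by simp [hb], by simp [hc], by simp [fromBlocks_smul]⟩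

theorem gPos_le_gOdd : gPos F n ≤ gOdd F n := by
  rintro _ ⟨b, hb, rfl⟩
  exact ⟨b, 0, hb, by simp, rfl⟩

theorem disjoint_g₀_gOdd : Disjoint (g₀ F n) (gOdd F n) := by
  rw [Submodule.disjoint_def]
  rintro _ ⟨a, rfl⟩ ⟨b, c, -, -, h⟩
  obtain ⟨rfl, -, -, -⟩ := fromBlocks_inj.1 h
  simp

theorem lie_g₀_g₀ : ∀ x ∈ g₀ F n, ∀ y ∈ g₀ F n, x * y - y * x ∈ g₀ F n := by
  rintro _ ⟨a, rfl⟩ _ ⟨b, rfl⟩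
  exact ⟨a * b - b * a, by simp [fromBlocks_multiply, sub_eq_add_neg, fromBlocks_neg,
    fromBlocks_add, add_comm]⟩

theorem lie_g₀_gPos : ∀ x ∈ g₀ F n, ∀ y ∈ gPos F n, x * y - y * x ∈ gPos F n := by
  rintro _ ⟨a, rfl⟩ _ ⟨b, hb, rfl⟩
  exact ⟨a * b + b * aᵀ, by simp [hb, add_comm], by
    simp [fromBlocks_multiply, sub_eq_add_neg, fromBlocks_neg, fromBlocks_add]⟩

theorem lie_g₀_gOdd : ∀ x ∈ g₀ F n, ∀ y ∈ gOdd F n, x * y - y * x ∈ gOdd F n := by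
  rintro _ ⟨a, rfl⟩ _ ⟨b, c, hb, hc, rfl⟩
  exact ⟨a * b + b * aᵀ, -(aᵀ * c) - c * a, by simp [hb, add_comm],
    by simp [hc], by
    simp [fromBlocks_multiply, sub_eq_add_neg, fromBlocks_neg, fromBlocks_add]⟩

theorem lie_gPos_gPos : ∀ x ∈ gPos F n, ∀ y ∈ gPos F n, x * y + y * x = 0 := by
  rintro _ ⟨a, -, rfl⟩ _ ⟨b, -, rfl⟩
  simp [fromBlocks_multiply]

theorem lie_gOdd_gOdd : ∀ x ∈ gOdd F n, ∀ y ∈ gOdd F n, x * y + y * x ∈ g₀ F n := by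
  rintro _ ⟨b, c, hb, hc, rfl⟩ _ ⟨b', c', hb', hc', rfl⟩
  exact ⟨b * c' + b' * c, by
    simp [fromBlocks_multiply, fromBlocks_add, hb, hc, hb', hc', add_comm]⟩

theorem fromBlocks_diag_pow (a d : Matrix (Fin n) (Fin n) F) (k : ℕ) :
    fromBlocks a 0 0 d ^ k = fromBlocks (a ^ k) 0 0 (d ^ k) := by
  induction k with
  | zero => simp
  | succ k ih => simp [pow_succ, ih, fromBlocks_multiply]

theorem pow_mem_g₀ (p : ℕ) [Fact p.Prime] [CharP F p] : ∀ x ∈ g₀ F n, x ^ p ∈ g₀ F n := by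
  rintro _ ⟨a, rfl⟩
  refine ⟨a ^ p, ?_⟩
  have h : (-aᵀ) ^ p = -(aᵀ ^ p) := by
    rcases (Fact.out : p.Prime).eq_two_or_odd' with rfl | hp
    · have h2 : (2 : F) = 0 := by exact_mod_cast CharP.cast_eq_zero F 2
      have hn : ∀ m : Matrix (Fin n) (Fin n) F, -m = m := by
        intro m
        ext i j
        have : m i j + m i j = 0 := by rw [← two_mul, h2, zero_mul]
        simpa using (eq_neg_of_add_eq_zero_left this).symm
      rw [hn, hn]
    · exact hp.neg_pow _
  rw [fromBlocks_diag_pow, h, transpose_pow]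

end Algebra

section Superalgebras

variable (F : Type*) [Field F] (n p : ℕ) [Fact p.Prime] [CharP F p]

/-- The restricted Lie superalgebra `𝔤 = 𝔭(n)`. -/
abbrev g : RestrictedLieSuperalgebra F (Mat F n) p where
  even := g₀ F n
  odd := gOdd F n
  disjoint := disjoint_g₀_gOdd F n
  lie_even_even := lie_g₀_g₀ F n
  lie_even_odd := lie_g₀_gOdd F n
  lie_odd_odd := lie_gOdd_gOdd F n
  pow_mem := pow_mem_g₀ F n p

/-- The subalgebra `𝔤⁺ = 𝔤₀ ⊕ 𝔤₁` of `𝔭(n)`. -/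
abbrev gPlus : RestrictedLieSuperalgebra F (Mat F n) p where
  even := g₀ F n
  odd := gPos F n
  disjoint := (disjoint_g₀_gOdd F n).mono_right (gPos_le_gOdd F n)
  lie_even_even := lie_g₀_g₀ F n
  lie_even_odd := lie_g₀_gPos F n
  lie_odd_odd x hx y hy := by rw [lie_gPos_gPos F n x hx y hy]; exact zero_mem _
  pow_mem := pow_mem_g₀ F n p

/-- The restricted Lie algebra `𝔤₀`, as a Lie superalgebra with zero odd part. -/
abbrev gZero : RestrictedLieSuperalgebra F (Mat F n) p where
  even := g₀ F n
  odd := ⊥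
  disjoint := disjoint_bot_right
  lie_even_even := lie_g₀_g₀ F n
  lie_even_odd x _ y hy := by rw [(Submodule.mem_bot F).1 hy]; simp
  lie_odd_odd x hx y hy := by
    rw [(Submodule.mem_bot F).1 hx, (Submodule.mem_bot F).1 hy]; simp
  pow_mem := pow_mem_g₀ F n p

variable (χ : Module.Dual F (g₀ F n))

/-- The algebra map `u_χ(𝔤⁺) → u_χ(𝔤)` induced by the inclusion of `𝔤⁺` in `𝔤`. -/
def incl : (gPlus F n p).Red χ →ₐ[F] (g F n p).Red χ :=
  (gPlus F n p).lift χ ((g F n p).ι₀ χ)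
    ((g F n p).ι₁ χ ∘ₗ Submodule.inclusion (gPos_le_gOdd F n))
    ((g F n p).ι₀_mul_ι₀ χ)
    (fun x y => (g F n p).ι₀_mul_ι₁ χ x (Submodule.inclusion (gPos_le_gOdd F n) y))
    (fun x y => (g F n p).ι₁_mul_ι₁ χ (Submodule.inclusion (gPos_le_gOdd F n) x)
      (Submodule.inclusion (gPos_le_gOdd F n) y))
    ((g F n p).ι₀_pow χ)

/-- The algebra map `u_χ(𝔤⁺) → u_χ(𝔤₀)` which is the identity on `𝔤₀` and kills `𝔤₁`.
Through it a `u_χ(𝔤₀)`-module is viewed as a `u_χ(𝔤⁺)`-module with `𝔤₁` acting by zero. -/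
def proj : (gPlus F n p).Red χ →ₐ[F] (gZero F n p).Red χ :=
  (gPlus F n p).lift χ ((gZero F n p).ι₀ χ) 0
    ((gZero F n p).ι₀_mul_ι₀ χ)
    (fun x y => by simp)
    (fun x y => by
      have h : (gPlus F n p).lie₁₁ x y = 0 := Subtype.ext (lie_gPos_gPos F n x x.2 y y.2)
      rw [h, map_zero]
      simp)
    ((gZero F n p).ι₀_pow χ)

/-- The `u_χ(𝔤)`-submodule of `u_χ(𝔤) ⊗_F M` spanned by the elements `a s ⊗ m - a ⊗ s m`, for
`s` in `u_χ(𝔤⁺)`. -/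
def balance (M : Type*) [AddCommGroup M] [Module F M] [Module ((gZero F n p).Red χ) M] :
    Submodule ((g F n p).Red χ) ((g F n p).Red χ ⊗[F] M) :=
  Submodule.span _ {t | ∃ (a : (g F n p).Red χ) (s : (gPlus F n p).Red χ) (m : M),
    t = (a * incl F n p χ s) ⊗ₜ[F] m - a ⊗ₜ[F] (proj F n p χ s • m)}

/-- The Kac module `K_χ(M) = u_χ(𝔤) ⊗_{u_χ(𝔤⁺)} M`, where `𝔤₁` acts by zero on `M`. -/
abbrev KacModule (M : Type*) [AddCommGroup M] [Module F M] [Module ((gZero F n p).Red χ) M] :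
    Type _ :=
  ((g F n p).Red χ ⊗[F] M) ⧸ balance F n p χ M

end Superalgebras

section Weights

variable {F : Type*} [Field F] {n : ℕ}

variable (F) in
/-- The element `e_{ij} - e_{j+n,i+n}` of `𝔤₀`. -/
def e (i j : Fin n) : g₀ F n :=
  ⟨fromBlocks (Matrix.single i j 1) 0 0 (-(Matrix.single i j 1)ᵀ), ⟨_, rfl⟩⟩

variable (F n) in
/-- The subalgebra `𝔫₀⁺` of `𝔤₀`, spanned by the positive root vectors. -/
def nPlus : Submodule F (g₀ F n) :=
  Submodule.span F {x | ∃ i j : Fin n, i < j ∧ x = e F i j}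

/-- `v` is a maximal vector of weight `μ = ∑ μ_i ε_i` in a `u_χ(𝔤₀)`-module. -/
def IsMaximalVector (p : ℕ) [Fact p.Prime] [CharP F p] (χ : Module.Dual F (g₀ F n))
    {M : Type*} [AddCommGroup M] [Module F M] [Module ((gZero F n p).Red χ) M]
    (v : M) (μ : Fin n → F) : Prop :=
  v ≠ 0 ∧ (∀ x ∈ nPlus F n, (gZero F n p).ι₀ χ x • v = 0) ∧
    ∀ i, (gZero F n p).ι₀ χ (e F i i) • v = μ i • v

/-- The scalar `δ_μ = ∏_{i<j} (μ_i - μ_j + j - i - 1)`. -/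
def delta (μ : Fin n → F) : F :=
  ∏ i, ∏ j ∈ Finset.Ioi i, (μ i - μ j + ((j : ℕ) : F) - ((i : ℕ) : F) - 1)

end Weights

end Periplectic

end

/-! Write K for the Kac module, 𝔤₋₁ for the skew-symmetric lower left blocks, y_P for the vector
e_{ij} - e_{ji} of 𝔤₋₁ attached to P = (i, j) with i < j, and Y for the product of all y_P.

The y_P anticommute and square to zero, and K is spanned by words in distinct y_P applied to the
image of M. Multiplying a nonzero element of a submodule N by suitable y_P gives Y w ∈ N with w ≠ 0
in the image of M (`exists_list_prod_smul_mem`). The top exterior power of 𝔤₋₁ is a line, so 𝔤₀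
commutes with Y up to multiples of Y (`exists_mul_list_prod_eq`). Hence {u | Y u ∈ N} is 𝔤₀-stable
and, M being simple, contains the image of M; in particular Y v ∈ N.

Order the factors of Y lexicographically. The element x_{ij} = e_{ij} + e_{ji} of 𝔤₁ strips the
leading factor y_{ij}: it satisfies x_{ij} y_{ij} = -y_{ij} x_{ij} + h_j - h_i, it kills the rest of
the word applied to v, and that rest is a weight vector. What remains is -(μ_i - μ_j + j - i - 1)
times the rest (`Relations.step`). As δ_μ ≠ 0, every factor can be stripped, so v ∈ N and N = K.

That K is nonzero is a separate matter, since the relations could a priori collapse M. An action of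
𝔤 is built on Λ(𝔤₋₁) ⊗ M (`modelRep`), and K maps to it compatibly with the inclusions of M, so M
embeds in K. Linear independence of the words in K is never needed. -/

noncomputable section

/-! ### Generation of the reduced enveloping algebra. -/

namespace RestrictedLieSuperalgebra

variable {F A : Type*} [CommRing F] [Ring A] [Algebra F A] {p : ℕ}

/-- `u_χ(L)` is generated as an algebra by the images of the even and the odd part of `L`. -/
theorem adjoin_range_ι (L : RestrictedLieSuperalgebra F A p) (χ : Module.Dual F L.even) :
    Algebra.adjoin F (Set.range (L.ι₀ χ) ∪ Set.range (L.ι₁ χ)) = ⊤ := by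
  have hsurj : Function.Surjective ((L.mkRed χ).comp L.mkEnv) :=
    (RingQuot.mkAlgHom_surjective F (L.RedRel χ)).comp (RingQuot.mkAlgHom_surjective F L.EnvRel)
  rw [eq_top_iff, ← (AlgHom.range_eq_top _).2 hsurj, ← Algebra.map_top,
    ← TensorAlgebra.adjoin_range_ι, AlgHom.map_adjoin]
  refine Algebra.adjoin_le ?_
  rintro _ ⟨_, ⟨⟨x, y⟩, rfl⟩, rfl⟩
  have h : (L.mkRed χ).comp L.mkEnv (TensorAlgebra.ι F (x, y)) = L.ι₀ χ x + L.ι₁ χ y := by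
    change L.mkRed χ (L.envι (x, y)) = L.mkRed χ (L.envι (x, 0)) + L.mkRed χ (L.envι (0, y))
    rw [← map_add, ← map_add]
    simp
  rw [SetLike.mem_coe, h]
  exact add_mem (Algebra.subset_adjoin (Or.inl ⟨x, rfl⟩)) (Algebra.subset_adjoin (Or.inr ⟨y, rfl⟩))

/-- A subspace of a `u_χ(L)`-module stable under `L` is stable under `u_χ(L)`. -/
theorem smul_mem_of_stable (L : RestrictedLieSuperalgebra F A p) (χ : Module.Dual F L.even)
    {K : Type*} [AddCommGroup K] [Module F K] [Module (L.Red χ) K] [IsScalarTower F (L.Red χ) K]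
    (W : Submodule F K) (h₀ : ∀ x, ∀ w ∈ W, L.ι₀ χ x • w ∈ W)
    (h₁ : ∀ x, ∀ w ∈ W, L.ι₁ χ x • w ∈ W) (u : L.Red χ) : ∀ w ∈ W, u • w ∈ W := by
  have hu : u ∈ Algebra.adjoin F (Set.range (L.ι₀ χ) ∪ Set.range (L.ι₁ χ)) := by
    rw [L.adjoin_range_ι χ]; trivial
  induction hu using Algebra.adjoin_induction with
  | mem x hx =>
    rcases hx with ⟨x, rfl⟩ | ⟨x, rfl⟩
    · exact h₀ x
    · exact h₁ x
  | algebraMap r =>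
    intro w hw
    rw [algebraMap_smul]
    exact W.smul_mem r hw
  | add x y _ _ hx hy =>
    intro w hw
    rw [add_smul]
    exact W.add_mem (hx w hw) (hy w hw)
  | mul x y _ _ hx hy =>
    intro w hw
    rw [mul_smul]
    exact hx _ (hy w hw)

end RestrictedLieSuperalgebra

/-- Applied to commuting left and right multiplications, this gives ad(x)^p = ad(x^p). The zero ring
is allowed because endomorphism rings may be trivial. -/
theorem sub_pow_char_of_commute_of_algebra (F : Type*) {R : Type*} [Field F] [Ring R] [Algebra F R]
    (p : ℕ) [Fact p.Prime] [CharP F p] {x y : R} (h : Commute x y) :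
    (x - y) ^ p = x ^ p - y ^ p := by
  cases subsingleton_or_nontrivial R
  · exact Subsingleton.elim _ _
  · have := charP_of_injective_algebraMap (algebraMap F R).injective p
    exact sub_pow_char_of_commute _ h

/-! ### Operators on Λ(V) ⊗ M: recursive construction and uniqueness. -/

namespace ExteriorAlgebra

variable (F V M : Type*) [Field F] [AddCommGroup V] [Module F V] [AddCommGroup M] [Module F M]

/-- Left multiplication by a vector on `Λ(V) ⊗ M`. -/
def wedge : V →ₗ[F] Module.End F (ExteriorAlgebra F V ⊗[F] M) :=
  LinearMap.rTensorHom M ∘ₗ LinearMap.mul F (ExteriorAlgebra F V) ∘ₗ ι F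

variable {F V M}

theorem wedge_tmul (c : V) (x : ExteriorAlgebra F V) (m : M) :
    wedge F V M c (x ⊗ₜ m) = (ι F c * x) ⊗ₜ m := rfl

theorem wedge_wedge_self (c : V) (k : ExteriorAlgebra F V ⊗[F] M) :
    wedge F V M c (wedge F V M c k) = 0 := by
  induction k with
  | zero => simp
  | tmul x m => simp [wedge_tmul, ← mul_assoc]
  | add x y hx hy => simp [hx, hy]

/-- An operator on `Λ(V) ⊗ M` which kills `1 ⊗ M` and commutes up to a scalar with the
multiplication operators is zero. -/
theorem eq_zero_of_wedge {T : Module.End F (ExteriorAlgebra F V ⊗[F] M)} (ε : F)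
    (h1 : ∀ m, T (1 ⊗ₜ m) = 0)
    (h : ∀ c k, T (wedge F V M c k) = ε • wedge F V M c (T k)) : T = 0 := by
  refine TensorProduct.ext' fun x m => ?_
  induction x using CliffordAlgebra.left_induction with
  | algebraMap r => rw [Algebra.algebraMap_eq_smul_one, TensorProduct.smul_tmul, h1]; rfl
  | add x y hx hy => rw [TensorProduct.add_tmul, map_add, hx, hy]; simp
  | ι_mul x c hx =>
    have := h c (x ⊗ₜ m)
    rw [hx] at this
    simpa [wedge_tmul] using this

/-- Recursive construction of operators on `Λ(V) ⊗ M`. -/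
theorem exists_operator (ε : F) (f : M →ₗ[F] ExteriorAlgebra F V ⊗[F] M)
    (G : V →ₗ[F] Module.End F (ExteriorAlgebra F V ⊗[F] M))
    (hG : ∀ c k, ε • wedge F V M c (G c k) + G c (wedge F V M c k) = 0) :
    ∃ T : Module.End F (ExteriorAlgebra F V ⊗[F] M), (∀ m, T (1 ⊗ₜ m) = f m) ∧
      ∀ c k, T (wedge F V M c k) = ε • wedge F V M c (T k) + G c k := by
  let K := ExteriorAlgebra F V ⊗[F] M
  -- One step of a right fold: x is the word read so far and φ is the value of `T` on x ⊗ -. The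
  -- word itself must be carried along because `G` is evaluated on it.
  let Φ : V →ₗ[F] ExteriorAlgebra F V × (M →ₗ[F] K) →ₗ[F] (M →ₗ[F] K) :=
    LinearMap.mk₂ F (fun c x => ε • (wedge F V M c ∘ₗ x.2) + G c ∘ₗ TensorProduct.mk F _ M x.1)
      (fun c d x => by ext m; simp; abel)
      (fun r c x => by ext m; simp [smul_comm ε r])
      (fun c x y => by ext m; simp; abel)
      (fun r c x => by ext m; simp [smul_comm ε r])
  have hΦ : ∀ c x φ m, Φ c (x, φ) m = ε • wedge F V M c (φ m) + G c (x ⊗ₜ m) := fun _ _ _ _ => rfl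
  -- The fold respects c ∧ c = 0: the terms with c twice vanish and the two mixed ones cancel by
  -- `hG`.
  have hΦ0 : ∀ c x φ, Φ c (CliffordAlgebra.ι 0 c * x, Φ c (x, φ)) = (0 : QuadraticForm F V) c • φ := by
    intro c x φ
    ext m
    rw [hΦ, hΦ]
    simp only [map_add, map_smul, wedge_wedge_self, smul_zero, zero_add]
    simp only [zero_apply, zero_smul, LinearMap.zero_apply]
    exact hG c (x ⊗ₜ m)
  let T : K →ₗ[F] K := TensorProduct.lift (CliffordAlgebra.foldr' 0 Φ hΦ0 f)
  refine ⟨T, fun m => ?_, fun c k => ?_⟩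
  · have h := CliffordAlgebra.foldr'_algebraMap 0 Φ hΦ0 f 1
    rw [map_one, one_smul] at h
    simp only [T, TensorProduct.lift.tmul]
    exact congrArg (· m) h
  · induction k with
    | zero => simp
    | tmul x m =>
      have h := CliffordAlgebra.foldr'_ι_mul 0 Φ hΦ0 f c x
      simp only [T, TensorProduct.lift.tmul, wedge_tmul]
      exact congrArg (· m) h
    | add x y hx hy => simp only [map_add, hx, hy, smul_add]; abel

/-- The properties of `K = Λ(V) ⊗ M`, with the multiplication operators `y` and the inclusion
`j` of `M`, which allow to define and compare operators on `K`. -/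
structure IsModel {K : Type*} [AddCommGroup K] [Module F K]
    (y : V →ₗ[F] Module.End F K) (j : M →ₗ[F] K) : Prop where
  sq_zero : ∀ c k, y c (y c k) = 0
  eq_zero : ∀ (T : Module.End F K) (ε : F), (∀ m, T (j m) = 0) →
    (∀ c k, T (y c k) = ε • y c (T k)) → T = 0
  exists_operator : ∀ (ε : F) (f : M →ₗ[F] K) (G : V →ₗ[F] Module.End F K),
    (∀ c k, ε • y c (G c k) + G c (y c k) = 0) →
    ∃ T : Module.End F K, (∀ m, T (j m) = f m) ∧ ∀ c k, T (y c k) = ε • y c (T k) + G c k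

theorem isModel_wedge :
    IsModel (wedge F V M) (TensorProduct.mk F (ExteriorAlgebra F V) M 1) where
  sq_zero := wedge_wedge_self
  eq_zero _ ε h1 h := eq_zero_of_wedge ε h1 h
  exists_operator ε f G hG := exists_operator ε f G hG

variable (F V M) in
/-- The inclusion of `M` in `Λ(V) ⊗ M` is injective. -/
theorem one_tmul_injective :
    Function.Injective (TensorProduct.mk F (ExteriorAlgebra F V) M 1) := by
  let r : ExteriorAlgebra F V ⊗[F] M →ₗ[F] M :=
    (TensorProduct.lid F M).toLinearMap ∘ₗ algebraMapInv.toLinearMap.rTensor M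
  refine Function.LeftInverse.injective (g := r) fun m => ?_
  simp [r]

namespace IsModel

variable {K : Type*} [AddCommGroup K] [Module F K] {y : V →ₗ[F] Module.End F K} {j : M →ₗ[F] K}
  (h : IsModel y j)

include h

theorem mul_add_mul (c d : V) (k : K) : y c (y d k) + y d (y c k) = 0 := by
  have h' := h.sq_zero (c + d) k
  simp only [map_add, LinearMap.add_apply, h.sq_zero] at h'
  simpa [add_comm] using h'

/-- The relations of 𝔤 on the model are checked by this lemma when they are even and by
`eq_of_anticomm` when they are odd: only the values on M and the commutation with 𝔤₋₁ have to be
compared. -/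
theorem eq_of_comm {T T' : Module.End F K} (h1 : ∀ m, (T - T') (j m) = 0)
    (h2 : ∀ c k, (T - T') (y c k) = y c ((T - T') k)) : T = T' :=
  sub_eq_zero.1 (h.eq_zero _ 1 h1 fun c k => by rw [h2, one_smul])

theorem eq_of_anticomm {T T' : Module.End F K} (h1 : ∀ m, (T - T') (j m) = 0)
    (h2 : ∀ c k, (T - T') (y c k) = -y c ((T - T') k)) : T = T' :=
  sub_eq_zero.1 (h.eq_zero _ (-1) h1 fun c k => by rw [h2, neg_smul, one_smul])

end IsModel

end ExteriorAlgebra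

namespace Periplectic

open Matrix RestrictedLieSuperalgebra ExteriorAlgebra

/-! ### 𝔤₋₁ and 𝔤₁ as modules over gl(n). -/

section Model

variable (F : Type*) [Field F] (n : ℕ)

/-- The skew-symmetric matrices. -/
def skew : Submodule F (Matrix (Fin n) (Fin n) F) where
  carrier := {c | cᵀ = -c}
  add_mem' := by
    intro a b (ha : aᵀ = -a) (hb : bᵀ = -b)
    simp [ha, hb, add_comm]
  zero_mem' := by simp
  smul_mem' := by
    intro r a (ha : aᵀ = -a)
    simp [ha]

/-- The symmetric matrices. -/
def symm : Submodule F (Matrix (Fin n) (Fin n) F) where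
  carrier := {b | bᵀ = b}
  add_mem' := by
    intro a b (ha : aᵀ = a) (hb : bᵀ = b)
    simp [ha, hb]
  zero_mem' := by simp
  smul_mem' := by
    intro r a (ha : aᵀ = a)
    simp [ha]

variable {F n}

theorem skew_transpose (c : skew F n) : (c : Matrix (Fin n) (Fin n) F)ᵀ = -c := c.2

theorem symm_transpose (b : symm F n) : (b : Matrix (Fin n) (Fin n) F)ᵀ = b := b.2

variable (F n) in
/-- The action of `gl(n)` on skew-symmetric matrices. -/
def skewAct : Matrix (Fin n) (Fin n) F →ₗ[F] skew F n →ₗ[F] skew F n :=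
  LinearMap.mk₂ F
    (fun a c => ⟨-(aᵀ * (c : Matrix (Fin n) (Fin n) F)) - c * a, by
      change _ᵀ = _
      simp [skew_transpose]⟩)
    (fun a b c => Subtype.ext (by simp [add_mul, mul_add]; abel))
    (fun r a c => Subtype.ext (by simp [smul_sub]))
    (fun a c d => Subtype.ext (by simp [add_mul, mul_add]; abel))
    (fun r a c => Subtype.ext (by simp [smul_sub]))

theorem skewAct_coe (a : Matrix (Fin n) (Fin n) F) (c : skew F n) :
    (skewAct F n a c : Matrix (Fin n) (Fin n) F) = -(aᵀ * c) - c * a := rfl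

variable (F n) in
/-- The action of `gl(n)` on symmetric matrices. -/
def symmAct : Matrix (Fin n) (Fin n) F →ₗ[F] symm F n →ₗ[F] symm F n :=
  LinearMap.mk₂ F
    (fun a b => ⟨a * (b : Matrix (Fin n) (Fin n) F) + b * aᵀ, by
      change _ᵀ = _
      simp [symm_transpose, add_comm]⟩)
    (fun a b c => Subtype.ext (by simp [add_mul, mul_add]; abel))
    (fun r a c => Subtype.ext (by simp))
    (fun a c d => Subtype.ext (by simp [add_mul, mul_add]; abel))
    (fun r a c => Subtype.ext (by simp))

theorem symmAct_coe (a : Matrix (Fin n) (Fin n) F) (b : symm F n) :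
    (symmAct F n a b : Matrix (Fin n) (Fin n) F) = a * b + b * aᵀ := rfl

theorem skewAct_lie (a b : Matrix (Fin n) (Fin n) F) (c : skew F n) :
    skewAct F n a (skewAct F n b c) - skewAct F n b (skewAct F n a c)
      = skewAct F n (a * b - b * a) c := by
  ext1
  simp only [AddSubgroupClass.coe_sub, skewAct_coe, transpose_sub, transpose_mul]
  noncomm_ring

/-- This is [[b, c], c] = 0, forced by [c, c] = 0 and the Jacobi identity. It is the compatibility
condition that makes `posOp` well defined. -/
theorem skewAct_mul_self (b : symm F n) (c : skew F n) :
    skewAct F n (b * c) c = 0 := by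
  ext1
  simp only [skewAct_coe, transpose_mul, symm_transpose, skew_transpose]
  simp [mul_assoc]

/-- The action is left multiplication by -aᵗ minus right multiplication by a. These commute, so the
p-th power can be taken termwise, once the operator is extended from skew-symmetric to all matrices.
-/
theorem skewAct_pow (p : ℕ) [Fact p.Prime] [CharP F p] (a : Matrix (Fin n) (Fin n) F) :
    skewAct F n a ^ p = skewAct F n (a ^ p) := by
  let D : Module.End F (Matrix (Fin n) (Fin n) F) := LinearMap.mulLeft F (-aᵀ) - LinearMap.mulRight F a
  have hD : ∀ k, ∀ c : skew F n, (((skewAct F n a ^ k) c : skew F n) : Matrix (Fin n) (Fin n) F) = (D ^ k) c := by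
    intro k
    induction k with
    | zero => simp
    | succ k ih =>
      intro c
      rw [pow_succ, pow_succ, Module.End.mul_apply, Module.End.mul_apply, ih]
      congr 1
      simp only [D, skewAct_coe, LinearMap.sub_apply, LinearMap.mulLeft_apply,
        LinearMap.mulRight_apply, neg_mul]
  have hneg : (-aᵀ) ^ p = -(a ^ p)ᵀ := by
    have h := pow_mem_g₀ F n p _ ⟨a, rfl⟩
    obtain ⟨b, hb⟩ := h
    rw [fromBlocks_diag_pow] at hb
    obtain ⟨h1, -, -, h2⟩ := fromBlocks_inj.1 hb
    rw [h2, h1]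
  have hDp : D ^ p = LinearMap.mulLeft F (-(a ^ p)ᵀ) - LinearMap.mulRight F (a ^ p) := by
    rw [sub_pow_char_of_commute_of_algebra F p (LinearMap.commute_mulLeft_right _ _),
      LinearMap.pow_mulLeft, LinearMap.pow_mulRight, hneg]
  ext1 c
  ext1
  rw [hD, hDp]
  simp only [skewAct_coe, LinearMap.sub_apply, LinearMap.mulLeft_apply,
    LinearMap.mulRight_apply, neg_mul]

end Model

/-! ### The action of 𝔤 on the model. -/

section Operators

variable {F : Type*} [Field F] {n : ℕ} {M : Type*} [AddCommGroup M] [Module F M]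
  {K : Type*} [AddCommGroup K] [Module F K] {y : skew F n →ₗ[F] Module.End F K} {j : M →ₗ[F] K}
  (hK : IsModel y j) (ρ : Matrix (Fin n) (Fin n) F →ₗ[F] Module.End F M)

-- Elements of 𝔤₀ must act as derivations with respect to 𝔤₋₁; the compatibility condition is the
-- anticommutation of the operators `y`.
include hK in
theorem exists_evenOp : ∃ T : Matrix (Fin n) (Fin n) F →ₗ[F] Module.End F K,
    (∀ a m, T a (j m) = j (ρ a m)) ∧
    ∀ a c k, T a (y c k) = y c (T a k) + y (skewAct F n a c) k := by
  have hex : ∀ a, ∃ T : Module.End F K, (∀ m, T (j m) = j (ρ a m)) ∧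
      ∀ c k, T (y c k) = y c (T k) + y (skewAct F n a c) k := by
    intro a
    obtain ⟨T, h1, h2⟩ := hK.exists_operator 1 (j ∘ₗ ρ a) (y ∘ₗ skewAct F n a) (fun c k => by
        simpa using hK.mul_add_mul c (skewAct F n a c) k)
    exact ⟨T, h1, fun c k => by simpa using h2 c k⟩
  choose T h1 h2 using hex
  -- The operators were chosen for each a separately; uniqueness makes the choice linear.
  refine ⟨{ toFun := T, map_add' := fun a b => ?_, map_smul' := fun r a => ?_ }, h1, h2⟩
  · refine hK.eq_of_comm (fun m => ?_) fun c k => ?_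
    · simp [h1]
    · simp [h2]; abel
  · refine hK.eq_of_comm (fun m => ?_) fun c k => ?_
    · simp [h1]
    · simp [h2]

/-- The action of `𝔤₀` on `Λ(𝔤₋₁) ⊗ M`. -/
def evenOp : Matrix (Fin n) (Fin n) F →ₗ[F] Module.End F K :=
  (exists_evenOp hK ρ).choose

theorem evenOp_apply (a m) : evenOp hK ρ a (j m) = j (ρ a m) :=
  (exists_evenOp hK ρ).choose_spec.1 a m

theorem evenOp_y (a c k) :
    evenOp hK ρ a (y c k) = y c (evenOp hK ρ a k) + y (skewAct F n a c) k :=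
  (exists_evenOp hK ρ).choose_spec.2 a c k

/-- The recursion is the only one possible in a Kac module: 𝔤₁ kills M, and [b, c] is the product `b
* c` in gl(n). -/
theorem exists_posOp : ∃ T : symm F n →ₗ[F] Module.End F K, (∀ b m, T b (j m) = 0) ∧
    ∀ b (c : skew F n) k, T b (y c k) = -y c (T b k) + evenOp hK ρ (b * c) k := by
  have hex : ∀ b : symm F n, ∃ T : Module.End F K, (∀ m, T (j m) = 0) ∧
      ∀ (c : skew F n) k, T (y c k) = -y c (T k) + evenOp hK ρ (b * c) k := by
    intro b
    obtain ⟨T, h1, h2⟩ := hK.exists_operator (-1) 0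
      (evenOp hK ρ ∘ₗ LinearMap.mulLeft F (b : Matrix (Fin n) (Fin n) F) ∘ₗ (skew F n).subtype)
      (fun c k => by simp [evenOp_y, skewAct_mul_self])
    exact ⟨T, h1, fun c k => by simpa using h2 c k⟩
  choose T h1 h2 using hex
  refine ⟨{ toFun := T, map_add' := fun a b => ?_, map_smul' := fun r a => ?_ }, h1, h2⟩
  · refine hK.eq_of_anticomm (fun m => ?_) fun c k => ?_
    · simp [h1]
    · simp [h2, add_mul]; abel
  · refine hK.eq_of_anticomm (fun m => ?_) fun c k => ?_
    · simp [h1]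
    · simp [h2]; abel

/-- The action of `𝔤₁` on `Λ(𝔤₋₁) ⊗ M`. -/
def posOp : symm F n →ₗ[F] Module.End F K :=
  (exists_posOp hK ρ).choose

theorem posOp_apply (b m) : posOp hK ρ b (j m) = 0 :=
  (exists_posOp hK ρ).choose_spec.1 b m

theorem posOp_y (b : symm F n) (c : skew F n) (k) : posOp hK ρ b (y c k) =
    -y c (posOp hK ρ b k) + evenOp hK ρ (b * c) k :=
  (exists_posOp hK ρ).choose_spec.2 b c k

variable (hρ : ∀ a b, ρ a * ρ b - ρ b * ρ a = ρ (a * b - b * a))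

include hρ in
theorem evenOp_lie (a b) : evenOp hK ρ a * evenOp hK ρ b - evenOp hK ρ b * evenOp hK ρ a =
    evenOp hK ρ (a * b - b * a) := by
  refine hK.eq_of_comm (fun m => ?_) fun c k => ?_
  · rw [LinearMap.sub_apply, evenOp_apply, ← hρ]
    simp [evenOp_apply]
  · have h := congrArg (fun d => y d k) (skewAct_lie a b c)
    rw [map_sub, LinearMap.sub_apply] at h
    simp only [LinearMap.sub_apply, Module.End.mul_apply, evenOp_y, map_sub (y _), map_add, ← h]
    abel

include hρ in
theorem evenOp_posOp (a) (b : symm F n) :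
    evenOp hK ρ a * posOp hK ρ b - posOp hK ρ b * evenOp hK ρ a = posOp hK ρ (symmAct F n a b) := by
  refine hK.eq_of_anticomm (fun m => ?_) fun c k => ?_
  · simp [evenOp_apply, posOp_apply]
  · have h := LinearMap.congr_fun (evenOp_lie hK ρ hρ a (b * c)) k
    -- The Jacobi identity [[a, b], c] = [a, [b, c]] - [b, [a, c]].
    have h2 : (symmAct F n a b : Matrix (Fin n) (Fin n) F) * (c : Matrix (Fin n) (Fin n) F) =
        (a * (b * c) - b * c * a) - b * (skewAct F n a c : Matrix (Fin n) (Fin n) F) := by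
      rw [symmAct_coe, skewAct_coe]
      noncomm_ring
    rw [LinearMap.sub_apply, LinearMap.sub_apply, Module.End.mul_apply, Module.End.mul_apply,
      posOp_y hK ρ (symmAct F n a b), h2, map_sub (evenOp hK ρ), LinearMap.sub_apply, ← h]
    simp only [LinearMap.sub_apply, Module.End.mul_apply, evenOp_y, posOp_y, map_sub (y _),
      map_add, map_neg]
    abel

include hρ in
theorem posOp_posOp (b d : symm F n) :
    posOp hK ρ b * posOp hK ρ d + posOp hK ρ d * posOp hK ρ b = 0 := by
  refine hK.eq_of_comm (fun m => ?_) fun c k => ?_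
  · simp [posOp_apply]
  · have h := LinearMap.congr_fun (evenOp_posOp hK ρ hρ (b * c) d) k
    have h' := LinearMap.congr_fun (evenOp_posOp hK ρ hρ (d * c) b) k
    -- The Jacobi identity for b, c, d, using [b, d] = 0.
    have h2 : symmAct F n (b * c) d = -symmAct F n (d * c) b := by
      ext1
      simp only [symmAct_coe, NegMemClass.coe_neg, transpose_mul, symm_transpose, skew_transpose]
      noncomm_ring
    rw [h2, map_neg, LinearMap.neg_apply, ← h'] at h
    simp only [LinearMap.sub_apply, Module.End.mul_apply] at h
    simp only [sub_zero, LinearMap.add_apply, Module.End.mul_apply, posOp_y, map_add, map_neg]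
    rw [← sub_eq_zero] at h
    rw [← sub_eq_zero, ← neg_eq_zero, ← h]
    abel

/-- For T = `evenOp hK ρ a`, ad(T) sends `y c` to `y (skewAct F n a c)`. Iterate p times and use
ad(T)^p = ad(T^p). -/
theorem evenOp_pow_y (p : ℕ) [Fact p.Prime] [CharP F p] (a) (c : skew F n) (k : K) :
    (evenOp hK ρ a ^ p) (y c k) =
      y c ((evenOp hK ρ a ^ p) k) + y (skewAct F n (a ^ p) c) k := by
  let D : Module.End F (Module.End F K) :=
    LinearMap.mulLeft F (evenOp hK ρ a) - LinearMap.mulRight F (evenOp hK ρ a)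
  have hD : ∀ k c, (D ^ k) (y c) = y ((skewAct F n a ^ k) c) := by
    intro k
    induction k with
    | zero => intro c; rfl
    | succ k ih =>
      intro c
      rw [pow_succ, pow_succ, Module.End.mul_apply, Module.End.mul_apply, ← ih]
      congr 1
      refine LinearMap.ext fun x => ?_
      simp only [D, LinearMap.sub_apply, LinearMap.mulLeft_apply, LinearMap.mulRight_apply,
        Module.End.mul_apply, evenOp_y, add_sub_cancel_left]
  have hDp : D ^ p = _ := sub_pow_char_of_commute_of_algebra F p
    (LinearMap.commute_mulLeft_right (R := F) (evenOp hK ρ a) (evenOp hK ρ a))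
  have h := hD p c
  rw [hDp, LinearMap.pow_mulLeft, LinearMap.pow_mulRight, skewAct_pow] at h
  have h' := LinearMap.congr_fun h k
  simp only [LinearMap.sub_apply, LinearMap.mulLeft_apply, LinearMap.mulRight_apply,
    Module.End.mul_apply] at h'
  rw [← h', add_sub_cancel]

/-- Both terms on the left have the same bracket with 𝔤₋₁, so their difference commutes with 𝔤₋₁ and
is determined by its value on M. Thus the p-character of M passes to the model. -/
theorem evenOp_pow (p : ℕ) [Fact p.Prime] [CharP F p] (a) (r : F)
    (ha : ρ a ^ p - ρ (a ^ p) = algebraMap F _ r) :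
    evenOp hK ρ a ^ p - evenOp hK ρ (a ^ p) = algebraMap F _ r := by
  refine hK.eq_of_comm (fun m => ?_) fun c k => ?_
  · have h : ∀ k : ℕ, (evenOp hK ρ a ^ k) (j m) = j ((ρ a ^ k) m) := by
      intro k
      induction k with
      | zero => rfl
      | succ k ih => rw [pow_succ', pow_succ', Module.End.mul_apply, Module.End.mul_apply, ih,
          evenOp_apply]
    have h2 := LinearMap.congr_fun ha m
    rw [LinearMap.sub_apply, Module.algebraMap_end_apply] at h2
    rw [LinearMap.sub_apply, LinearMap.sub_apply, Module.algebraMap_end_apply, h, evenOp_apply,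
      ← map_sub, h2, map_smul, sub_self]
  · simp only [LinearMap.sub_apply, Module.algebraMap_end_apply, evenOp_pow_y, evenOp_y,
      map_sub, map_smul]
    abel

end Operators

end Periplectic

/-! ### Products of anticommuting elements of square zero. -/

section AnticommutingFamily

variable {F A ι : Type*} [Field F] [Ring A] [Algebra F A] {Y : ι → A}

theorem list_prod_mul_anticomm (hY : ∀ P Q, Y P * Y Q = -(Y Q * Y P)) (Q : ι) (L : List ι) :
    (L.map Y).prod * Y Q = (-1) ^ L.length * (Y Q * (L.map Y).prod) := by
  induction L with
  | nil => simp
  | cons P L ih =>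
    have h := hY Q P
    simp only [List.map_cons, List.prod_cons, List.length_cons, mul_assoc, ih]
    rw [← mul_assoc (Y Q), h, (Commute.neg_one_left (Y P)).pow_left _ |>.symm.left_comm, pow_succ]
    simp [mul_assoc]

theorem mul_list_prod_eq_zero (hY : ∀ P Q, Y P * Y Q = -(Y Q * Y P)) (hsq : ∀ P, Y P * Y P = 0)
    {Q : ι} {L : List ι} (hQ : Q ∈ L) : Y Q * (L.map Y).prod = 0 := by
  induction L with
  | nil => simp at hQ
  | cons P L ih =>
    rw [List.map_cons, List.prod_cons, ← mul_assoc]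
    rcases List.mem_cons.1 hQ with rfl | hQ
    · rw [hsq, zero_mul]
    · rw [hY Q P, neg_mul, mul_assoc, ih hQ, mul_zero, neg_zero]

theorem list_prod_mul_eq_zero (hY : ∀ P Q, Y P * Y Q = -(Y Q * Y P)) (hsq : ∀ P, Y P * Y P = 0)
    {Q : ι} {L : List ι} (hQ : Q ∈ L) : (L.map Y).prod * Y Q = 0 := by
  rw [list_prod_mul_anticomm hY, mul_list_prod_eq_zero hY hsq hQ, mul_zero]

/-- Expand [a, Y_{L₂}] by the Leibniz rule, with `L₁` collecting the factors already passed.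
Replacing a factor Y_P by some Y_Q with Q ≠ P repeats a letter and gives zero, so only multiples of
the full product survive. -/
theorem list_prod_mul_lie_mem_span (hY : ∀ P Q, Y P * Y Q = -(Y Q * Y P))
    (hsq : ∀ P, Y P * Y P = 0) (a : A) (L₂ : List ι) : ∀ L₁ : List ι,
    (∀ P ∈ L₂, a * Y P - Y P * a ∈ Submodule.span F (Y '' {Q | Q ∈ L₁ ++ L₂})) →
    (L₁.map Y).prod * (a * (L₂.map Y).prod - (L₂.map Y).prod * a) ∈
      Submodule.span F {((L₁ ++ L₂).map Y).prod} := by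
  induction L₂ with
  | nil => intro L₁ _; simp
  | cons P L ih =>
    intro L₁ h
    have e : L₁ ++ P :: L = (L₁ ++ [P]) ++ L := by simp
    have h1 := ih (L₁ ++ [P]) (fun Q hQ => e ▸ h Q (List.mem_cons_of_mem _ hQ))
    rw [← e] at h1
    have key : ∀ z ∈ Submodule.span F (Y '' {Q | Q ∈ L₁ ++ P :: L}),
        (L₁.map Y).prod * z * (L.map Y).prod ∈
          Submodule.span F {((L₁ ++ P :: L).map Y).prod} := by
      intro z hz
      induction hz using Submodule.span_induction with
      | zero => simp
      | add x y _ _ hx hy => rw [mul_add, add_mul]; exact add_mem hx hy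
      | smul r x _ hx => rw [mul_smul_comm, smul_mul_assoc]; exact Submodule.smul_mem _ _ hx
      | mem x hx =>
        obtain ⟨Q, hQ, rfl⟩ := hx
        rcases List.mem_append.1 hQ with hQ | hQ
        · rw [list_prod_mul_eq_zero hY hsq hQ, zero_mul]; exact zero_mem _
        · rcases List.mem_cons.1 hQ with rfl | hQ
          · refine Submodule.subset_span ?_
            simp [mul_assoc]
          · rw [mul_assoc, mul_list_prod_eq_zero hY hsq hQ, mul_zero]; exact zero_mem _
    have h2 := add_mem (key _ (h P List.mem_cons_self)) h1
    convert h2 using 1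
    simp only [List.map_cons, List.map_append, List.map_nil, List.prod_append, List.prod_cons,
      List.prod_nil]
    noncomm_ring

theorem exists_mul_list_prod_eq (hY : ∀ P Q, Y P * Y Q = -(Y Q * Y P))
    (hsq : ∀ P, Y P * Y P = 0) (a : A) (L : List ι)
    (h : ∀ P ∈ L, a * Y P - Y P * a ∈ Submodule.span F (Y '' {Q | Q ∈ L})) :
    ∃ r : F, a * (L.map Y).prod = (L.map Y).prod * a + r • (L.map Y).prod := by
  have := list_prod_mul_lie_mem_span hY hsq a L [] (by simpa using h)
  obtain ⟨r, hr⟩ := Submodule.mem_span_singleton.1 this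
  refine ⟨r, ?_⟩
  simp only [List.nil_append, List.map_nil, List.prod_nil, one_mul] at hr
  rw [hr]; abel

variable {K : Type*} [AddCommGroup K] [Module F K] [Module A K] [IsScalarTower F A K]

variable (Y) in
/-- The span of the products of sublists of `L`, applied to a subspace. -/
def wordSpan (W : Submodule F K) : List ι → Submodule F K
  | [] => W
  | P :: L => wordSpan W L ⊔ (wordSpan W L).map (Algebra.lsmul F F K (Y P))

theorem le_wordSpan (W : Submodule F K) (L : List ι) : W ≤ wordSpan Y W L := by
  induction L with
  | nil => exact le_rfl
  | cons P L ih => exact ih.trans le_sup_left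

theorem smul_mem_wordSpan (hY : ∀ P Q, Y P * Y Q = -(Y Q * Y P)) (hsq : ∀ P, Y P * Y P = 0)
    (W : Submodule F K) {Q : ι} {L : List ι} (hQ : Q ∈ L) {w : K} (hw : w ∈ wordSpan Y W L) :
    Y Q • w ∈ wordSpan Y W L := by
  induction L generalizing w with
  | nil => simp at hQ
  | cons P L ih =>
    obtain ⟨u, hu, _, ⟨t, ht, rfl⟩, rfl⟩ := Submodule.mem_sup.1 hw
    simp only [Algebra.lsmul_coe, smul_add]
    rcases eq_or_ne Q P with rfl | hne
    · rw [← mul_smul, hsq, zero_smul, add_zero]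
      exact Submodule.mem_sup_right ⟨u, hu, rfl⟩
    · have hQ' : Q ∈ L := (List.mem_cons.1 hQ).resolve_left hne
      refine add_mem (Submodule.mem_sup_left (ih hQ' hu)) (Submodule.mem_sup_right ?_)
      rw [← mul_smul, hY, neg_smul, mul_smul]
      exact neg_mem ⟨_, ih hQ' ht, rfl⟩

/-- A nonzero element of a subspace stable under an anticommuting family yields an element
of the form `Y_L w` with `w ≠ 0`. -/
theorem exists_list_prod_smul_mem (hY : ∀ P Q, Y P * Y Q = -(Y Q * Y P))
    (hsq : ∀ P, Y P * Y P = 0) (W : Submodule F K) (L : List ι) (N : Submodule F K)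
    (hN : ∀ P, ∀ w ∈ N, Y P • w ∈ N) {x : K} (hx : x ≠ 0) (hxN : x ∈ N)
    (hxW : x ∈ wordSpan Y W L) : ∃ w ∈ W, w ≠ 0 ∧ (L.map Y).prod • w ∈ N := by
  induction L generalizing N x with
  | nil => exact ⟨x, hxW, hx, by simpa using hxN⟩
  | cons P L ih =>
    -- The induction passes to {w | Y_P w ∈ N}. Write x = u + Y_P t with u, t in the span for the
    -- shorter list. If u ≠ 0 then Y_P x = Y_P u shows u ∈ `N₁`; otherwise t ∈ `N₁`, and t ≠ 0 since
    -- x ≠ 0.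
    let N₁ := N.comap (Algebra.lsmul F F K (Y P))
    have hN₁ : ∀ Q, ∀ w ∈ N₁, Y Q • w ∈ N₁ := by
      intro Q w (hw : Y P • w ∈ N)
      change Y P • Y Q • w ∈ N
      rw [← mul_smul, hY, neg_smul, mul_smul]
      exact neg_mem (hN Q _ hw)
    suffices h : ∃ u ∈ N₁, u ≠ 0 ∧ u ∈ wordSpan Y W L by
      obtain ⟨u, hu, hu0, huW⟩ := h
      obtain ⟨w, hw, hw0, hwN⟩ := ih N₁ hN₁ hu0 hu huW
      refine ⟨w, hw, hw0, ?_⟩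
      rw [List.map_cons, List.prod_cons, mul_smul]
      exact hwN
    obtain ⟨u, hu, _, ⟨t, ht, rfl⟩, rfl⟩ := Submodule.mem_sup.1 hxW
    simp only [Algebra.lsmul_coe] at hx hxN
    by_cases hu0 : u = 0
    · subst hu0
      rw [zero_add] at hx hxN
      exact ⟨t, hxN, fun h => hx (by rw [h, smul_zero]), ht⟩
    · refine ⟨u, ?_, hu0, hu⟩
      have := hN P _ hxN
      rwa [smul_add, ← mul_smul, hsq, zero_smul, add_zero] at this

end AnticommutingFamily

namespace Periplectic

open Matrix RestrictedLieSuperalgebra ExteriorAlgebra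

/-! ### The ordering of the roots of 𝔤₋₁ and the shift j - i - 1. -/

section Weights

variable {n : ℕ}

/-- The (lexicographic) order in which the roots of `𝔤₋₁` are applied. -/
def RootLT (P Q : Fin n × Fin n) : Prop := P.1 < Q.1 ∨ P.1 = Q.1 ∧ P.2 < Q.2

/-- A list of pairs `i < j` which is increasing and closed upwards for the order `RootLT`. -/
structure IsUpper (L : List (Fin n × Fin n)) : Prop where
  pairwise : L.Pairwise RootLT
  lt : ∀ Q ∈ L, Q.1 < Q.2
  mem : ∀ P ∈ L, ∀ Q : Fin n × Fin n, Q.1 < Q.2 → RootLT P Q → Q ∈ L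

theorem IsUpper.mem_tail_iff {P : Fin n × Fin n} {L : List (Fin n × Fin n)}
    (h : IsUpper (P :: L)) (Q : Fin n × Fin n) : Q ∈ L ↔ Q.1 < Q.2 ∧ RootLT P Q := by
  refine ⟨fun hQ => ⟨h.lt Q (List.mem_cons_of_mem _ hQ), List.rel_of_pairwise_cons h.pairwise hQ⟩,
    fun hQ => (List.mem_cons.1 (h.mem P List.mem_cons_self Q hQ.1 hQ.2)).resolve_left ?_⟩
  rintro rfl
  have := hQ.2
  simp [RootLT] at this

theorem IsUpper.tail {P : Fin n × Fin n} {L : List (Fin n × Fin n)} (h : IsUpper (P :: L)) :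
    IsUpper L where
  pairwise := h.pairwise.of_cons
  lt Q hQ := h.lt Q (List.mem_cons_of_mem _ hQ)
  mem P' hP' Q hQ hPQ := by
    refine (h.mem_tail_iff Q).2 ⟨hQ, ?_⟩
    have := ((h.mem_tail_iff P').1 hP').2
    simp only [RootLT, Fin.lt_def, Fin.ext_iff] at *
    omega

theorem IsUpper.nodup {L : List (Fin n × Fin n)} (h : IsUpper L) : L.Nodup :=
  h.pairwise.imp (by rintro P Q h rfl; simp [RootLT] at h)

variable (n) in
theorem exists_isUpper : ∃ L : List (Fin n × Fin n), IsUpper L ∧ ∀ P, P ∈ L ↔ P.1 < P.2 := by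
  let S : Finset (Fin n ×ₗ Fin n) := Finset.univ.filter fun P => (ofLex P).1 < (ofLex P).2
  let L := S.sort.map ofLex
  have hL : ∀ P, P ∈ L ↔ P.1 < P.2 := by
    intro P
    simp [L, S]
  refine ⟨L, ⟨?_, fun Q hQ => (hL Q).1 hQ, fun P _ Q hQ _ => (hL Q).2 hQ⟩, hL⟩
  refine List.pairwise_map.2 ((Finset.sortedLT_sort S).pairwise.imp ?_)
  intro P Q h
  exact Prod.Lex.lt_iff.1 h

/-- This produces the shift in δ_μ. Among the pairs after (i, j), those containing j are (j, l) with
l > j and (k, j) with i < k < j; those containing i are (i, l) with l > j. The families indexed by l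
cancel, leaving the j - i - 1 values of k. -/
theorem sum_tail_weight (F : Type*) [Field F] {i j : Fin n} (hij : i < j)
    {L : List (Fin n × Fin n)} (h : IsUpper ((i, j) :: L)) :
    (L.map fun Q => (if Q.1 = j then (1 : F) else 0) + if Q.2 = j then 1 else 0).sum -
      (L.map fun Q => (if Q.1 = i then (1 : F) else 0) + if Q.2 = i then 1 else 0).sum =
      (j : ℕ) - (i : ℕ) - 1 := by
  classical
  have hL : L.toFinset = Finset.univ.filter fun Q => Q.1 < Q.2 ∧ RootLT (i, j) Q := by
    ext Q
    simp [h.mem_tail_iff]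
  have h1 : ∀ k l : Fin n, (if k < l ∧ RootLT (i, j) (k, l) then if k = j then (1 : F) else 0 else 0)
      = if k = j then (if j < l then 1 else 0) else 0 := by
    intro k l
    by_cases hk : k = j
    · subst hk; simp [RootLT, hij]
    · simp [hk]
  have h2 : ∀ k l : Fin n, (if k < l ∧ RootLT (i, j) (k, l) then if l = j then (1 : F) else 0 else 0)
      = if l = j then (if k ∈ Finset.Ioo i j then 1 else 0) else 0 := by
    intro k l
    by_cases hl : l = j
    · subst hl; simp [RootLT, and_comm]
    · simp [hl]
  have h3 : ∀ k l : Fin n, (if k < l ∧ RootLT (i, j) (k, l) then if k = i then (1 : F) else 0 else 0)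
      = if k = i then (if j < l then 1 else 0) else 0 := by
    intro k l
    by_cases hk : k = i
    · subst hk
      have : (k < l ∧ j < l) ↔ j < l := ⟨And.right, fun h => ⟨hij.trans h, h⟩⟩
      simp [RootLT, this]
    · simp [hk]
  have h4 : ∀ k l : Fin n, (if k < l ∧ RootLT (i, j) (k, l) then if l = i then (1 : F) else 0 else 0)
      = 0 := by
    intro k l
    simp only [RootLT, Fin.lt_def, Fin.ext_iff]
    split_ifs <;> first | rfl | omega
  rw [← List.sum_toFinset _ h.tail.nodup, ← List.sum_toFinset _ h.tail.nodup, hL,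
    Finset.sum_add_distrib, Finset.sum_add_distrib]
  simp only [Finset.sum_filter, Fintype.sum_prod_type, h1, h2, h3, h4]
  rw [Finset.sum_comm]
  simp only [Finset.sum_ite_eq', Finset.mem_univ, if_true]
  have hcast : ((j : ℕ) : F) - (i : ℕ) - 1 = (((j : ℕ) - (i : ℕ) - 1 : ℕ) : F) := by
    rw [Nat.sub_sub, Nat.cast_sub (Nat.succ_le_of_lt hij)]
    push_cast
    ring
  have hfilter : (Finset.univ.filter fun k => i < k ∧ k < j) = Finset.Ioo i j := by
    ext k
    simp
  rw [hcast, ← Fin.card_Ioo, ← hfilter]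
  simp

end Weights

/-! ### Bases of 𝔤₋₁ and 𝔤₁. -/

section MatrixUnits

variable (F : Type*) [Field F] {n : ℕ}

/-- The skew-symmetric matrix `e_{ij} - e_{ji}`. -/
def skewUnit (i j : Fin n) : skew F n :=
  ⟨single i j 1 - single j i 1, by change _ᵀ = _; simp⟩

/-- The symmetric matrix `e_{ij} + e_{ji}`. -/
def symmUnit (i j : Fin n) : symm F n :=
  ⟨single i j 1 + single j i 1, by change _ᵀ = _; simp [add_comm]⟩

theorem skewUnit_self (i : Fin n) : skewUnit F i i = 0 := Subtype.ext (sub_self _)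

theorem skewUnit_swap (i j : Fin n) : skewUnit F j i = -skewUnit F i j :=
  Subtype.ext (neg_sub _ _).symm

variable {F}

theorem single_mul_single_eq (i j k l : Fin n) :
    (single i j 1 * single k l 1 : Matrix (Fin n) (Fin n) F) =
      if j = k then single i l 1 else 0 := by
  split_ifs with h
  · subst h; simp
  · simp [h]

theorem skewAct_single (i j k l : Fin n) :
    skewAct F n (single i j 1) (skewUnit F k l) =
      -(if i = k then skewUnit F j l else 0) - if i = l then skewUnit F k j else 0 := by
  ext1
  have h : ∀ (q : Prop) [Decidable q] (c : skew F n),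
      ((if q then c else 0 : skew F n) : Matrix (Fin n) (Fin n) F) = if q then (c : Matrix _ _ F) else 0 := by
    intro q _ c; split_ifs <;> rfl
  simp only [AddSubgroupClass.coe_sub, NegMemClass.coe_neg, h, skewAct_coe, skewUnit,
    transpose_single, mul_sub, sub_mul, single_mul_single_eq, eq_comm (a := l) (b := i),
    eq_comm (a := k) (b := i)]
  split_ifs <;> abel

theorem symmUnit_mul_skewUnit (i j k l : Fin n) :
    (symmUnit F i j : Matrix (Fin n) (Fin n) F) * (skewUnit F k l : Matrix (Fin n) (Fin n) F) =
      (if j = k then single i l 1 else 0) - (if j = l then single i k 1 else 0)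
        + (if i = k then single j l 1 else 0) - if i = l then single j k 1 else 0 := by
  simp only [symmUnit, skewUnit, mul_sub, add_mul, single_mul_single_eq]
  abel

/-- Summing over all ordered pairs counts c twice, hence the factor 1/2. In characteristic 2 the
condition cᵗ = -c would allow a nonzero diagonal. -/
theorem mem_span_skewUnit (h2 : (2 : F) ≠ 0) (c : skew F n) :
    c ∈ Submodule.span F ((fun P : Fin n × Fin n => skewUnit F P.1 P.2) '' {P | P.1 < P.2}) := by
  have hmem : ∀ i j, skewUnit F i j ∈
      Submodule.span F ((fun P : Fin n × Fin n => skewUnit F P.1 P.2) '' {P | P.1 < P.2}) := by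
    intro i j
    rcases lt_trichotomy i j with h | rfl | h
    · exact Submodule.subset_span ⟨(i, j), h, rfl⟩
    · rw [skewUnit_self]; exact zero_mem _
    · rw [skewUnit_swap]; exact neg_mem (Submodule.subset_span ⟨(j, i), h, rfl⟩)
  have hc : c = (2 : F)⁻¹ • ∑ i, ∑ j, (c : Matrix (Fin n) (Fin n) F) i j • skewUnit F i j := by
    ext1
    have h1 := Matrix.matrix_eq_sum_single (c : Matrix (Fin n) (Fin n) F)
    have h3 : ∑ i, ∑ j, (c : Matrix (Fin n) (Fin n) F) i j • (single j i 1 : Matrix _ _ F) = -c := by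
      rw [← skew_transpose, Matrix.matrix_eq_sum_single (cᵀ : Matrix (Fin n) (Fin n) F),
        Finset.sum_comm]
      simp
    rw [eq_comm, Submodule.coe_smul, inv_smul_eq_iff₀ h2]
    simp only [Submodule.coe_sum, Submodule.coe_smul, skewUnit, smul_sub, Finset.sum_sub_distrib, h3]
    simp only [smul_single, smul_eq_mul, mul_one]
    rw [← h1, sub_neg_eq_add, two_smul]
  rw [hc]
  exact Submodule.smul_mem _ _ (sum_mem fun i _ => sum_mem fun j _ => Submodule.smul_mem _ _ (hmem i j))

end MatrixUnits

/-- The commutation relations of `𝔭(n)` for linear maps `a`, `x`, `y` on `𝔤₀`, `𝔤₁`, `𝔤₋₁`. -/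
structure Relations {F A : Type*} [Field F] [Ring A] [Algebra F A] {n : ℕ}
    (a : Matrix (Fin n) (Fin n) F →ₗ[F] A) (x : symm F n →ₗ[F] A) (y : skew F n →ₗ[F] A) :
    Prop where
  a_mul_y : ∀ s c, a s * y c = y c * a s + y (skewAct F n s c)
  x_mul_y : ∀ (b : symm F n) (c : skew F n), x b * y c = -(y c * x b) + a (b * c)
  y_mul_y : ∀ c d, y c * y d = -(y d * y c)

/-! ### The simplicity criterion. -/

namespace Relations

variable {F A : Type*} [Field F] [Ring A] [Algebra F A] {n : ℕ}
  {a : Matrix (Fin n) (Fin n) F →ₗ[F] A} {x : symm F n →ₗ[F] A} {y : skew F n →ₗ[F] A}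
  (h : Relations a x y)

include h

theorem y_mul_self (h2 : (2 : F) ≠ 0) (c : skew F n) : y c * y c = 0 := by
  have h1 := h.y_mul_y c c
  rw [eq_neg_iff_add_eq_zero, ← two_smul F] at h1
  exact (smul_eq_zero_iff_right h2).1 h1

variable {K : Type*} [AddCommGroup K] [Module F K] [Module A K] [IsScalarTower F A K]

/-- A subspace containing `W` and stable under `𝔤₋₁` is everything, if `W` is stable under
`𝔤₀`, killed by `𝔤₁`, and generates. -/
theorem eq_top_of_y_stable (W : Submodule F K) (ha : ∀ s, ∀ w ∈ W, a s • w ∈ W)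
    (hx : ∀ b, ∀ w ∈ W, x b • w = 0)
    (hgen : ∀ N : Submodule F K, W ≤ N → (∀ s, ∀ w ∈ N, a s • w ∈ N) →
      (∀ b, ∀ w ∈ N, x b • w ∈ N) → (∀ c, ∀ w ∈ N, y c • w ∈ N) → N = ⊤)
    (N : Submodule F K) (hWN : W ≤ N) (hN : ∀ c, ∀ w ∈ N, y c • w ∈ N) : N = ⊤ := by
  -- The smallest 𝔤₋₁-stable subspace containing `W`; it suffices that 𝔤₀ and then 𝔤₁ preserve it.
  let N₀ : Submodule F K := sInf {N | W ≤ N ∧ ∀ c, ∀ w ∈ N, y c • w ∈ N}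
  have hle : ∀ N : Submodule F K, W ≤ N → (∀ c, ∀ w ∈ N, y c • w ∈ N) → N₀ ≤ N :=
    fun N h1 h2 => sInf_le ⟨h1, h2⟩
  have hWN₀ : W ≤ N₀ := le_sInf fun N hN => hN.1
  have hy : ∀ c, ∀ w ∈ N₀, y c • w ∈ N₀ := by
    intro c w hw
    refine Submodule.mem_sInf.2 fun N hN => hN.2 c w (Submodule.mem_sInf.1 hw N hN)
  have ha₀ : ∀ s, ∀ w ∈ N₀, a s • w ∈ N₀ := by
    -- The elements of `N₀` that 𝔤₀ keeps inside `N₀` contain `W` and are 𝔤₋₁-stable, so minimality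
    -- makes them all of `N₀`. The same argument serves for 𝔤₁ and uses the stability under 𝔤₀.
    let N₁ : Submodule F K := N₀ ⊓ ⨅ s, N₀.comap (Algebra.lsmul F F K (a s))
    have hN₁ : ∀ w, w ∈ N₁ ↔ w ∈ N₀ ∧ ∀ s, a s • w ∈ N₀ := by
      intro w; simp [N₁, Submodule.mem_inf, Submodule.mem_iInf]
    have := hle N₁ (fun w hw => (hN₁ w).2 ⟨hWN₀ hw, fun s => hWN₀ (ha s w hw)⟩) (by
      intro c w hw
      obtain ⟨h1, h2⟩ := (hN₁ w).1 hw
      refine (hN₁ _).2 ⟨hy c w h1, fun s => ?_⟩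
      rw [← mul_smul, h.a_mul_y, add_smul, mul_smul]
      exact add_mem (hy c _ (h2 s)) (hy _ w h1))
    exact fun s w hw => ((hN₁ w).1 (this hw)).2 s
  have hx₀ : ∀ b, ∀ w ∈ N₀, x b • w ∈ N₀ := by
    let N₁ : Submodule F K := N₀ ⊓ ⨅ b, N₀.comap (Algebra.lsmul F F K (x b))
    have hN₁ : ∀ w, w ∈ N₁ ↔ w ∈ N₀ ∧ ∀ b, x b • w ∈ N₀ := by
      intro w; simp [N₁, Submodule.mem_inf, Submodule.mem_iInf]
    have := hle N₁ (fun w hw => (hN₁ w).2 ⟨hWN₀ hw, fun b => by rw [hx b w hw]; exact zero_mem _⟩)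
      (by
      intro c w hw
      obtain ⟨h1, h2⟩ := (hN₁ w).1 hw
      refine (hN₁ _).2 ⟨hy c w h1, fun b => ?_⟩
      rw [← mul_smul, h.x_mul_y, add_smul, neg_smul, mul_smul]
      exact add_mem (neg_mem (hy c _ (h2 b))) (ha₀ _ w h1))
    exact fun b w hw => ((hN₁ w).1 (this hw)).2 b
  exact top_le_iff.1 ((hgen N₀ hWN₀ ha₀ hx₀ hy).symm.le.trans (hle N hWN hN))

variable {v : K} {μ : Fin n → F}

omit [Module F K] [IsScalarTower F A K] in
-- Bracketing e_{ij} with y_P replaces an index i of P by the larger j. Up to sign the result is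
-- zero or a y_Q with Q after P, which already occurs in the rest of the word, so the product
-- vanishes.
theorem pos_smul_eq_zero (h2 : (2 : F) ≠ 0) (hv : ∀ i j, i < j → a (single i j 1) • v = 0)
    {L : List (Fin n × Fin n)} (hL : IsUpper L) {i j : Fin n} (hij : i < j) :
    a (single i j 1) • (L.map fun P => y (skewUnit F P.1 P.2)).prod • v = 0 := by
  induction L with
  | nil => simpa using hv i j hij
  | cons P L ih =>
    have kill : ∀ Q : Fin n × Fin n, Q.1 < Q.2 → RootLT P Q →
        y (skewUnit F Q.1 Q.2) * (L.map fun P => y (skewUnit F P.1 P.2)).prod = 0 :=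
      fun Q h1 h3 => mul_list_prod_eq_zero (Y := fun P : Fin n × Fin n => y (skewUnit F P.1 P.2))
        (fun _ _ => h.y_mul_y _ _) (fun _ => h.y_mul_self h2 _) ((hL.mem_tail_iff Q).2 ⟨h1, h3⟩)
    have hP := hL.lt P List.mem_cons_self
    rw [List.map_cons, List.prod_cons, ← mul_smul, ← mul_assoc, h.a_mul_y, add_mul, add_smul,
      mul_assoc, mul_smul, mul_smul, ih hL.tail, smul_zero, zero_add, skewAct_single]
    have e1 : i = P.1 →
        y (skewUnit F j P.2) * (L.map fun P => y (skewUnit F P.1 P.2)).prod = 0 := by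
      rintro rfl
      rcases lt_trichotomy j P.2 with h3 | h3 | h3
      · exact kill (j, P.2) h3 (Or.inl hij)
      · rw [h3, skewUnit_self, map_zero, zero_mul]
      · rw [skewUnit_swap, map_neg, neg_mul, kill (P.2, j) h3 (Or.inl hP), neg_zero]
    have e2 : i = P.2 →
        y (skewUnit F P.1 j) * (L.map fun P => y (skewUnit F P.1 P.2)).prod = 0 := by
      rintro rfl
      exact kill (P.1, j) (hP.trans hij) (Or.inr ⟨rfl, hij⟩)
    rw [map_sub, map_neg, sub_mul, neg_mul]
    have e1' : y (if i = P.1 then skewUnit F j P.2 else 0) *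
        (L.map fun P => y (skewUnit F P.1 P.2)).prod = 0 := by
      split_ifs with h3
      · exact e1 h3
      · simp
    have e2' : y (if i = P.2 then skewUnit F P.1 j else 0) *
        (L.map fun P => y (skewUnit F P.1 P.2)).prod = 0 := by
      split_ifs with h3
      · exact e2 h3
      · simp
    rw [e1', e2', neg_zero, sub_zero, zero_smul]

omit [Module F K] [IsScalarTower F A K] in
-- For P after (i, j), the bracket of x_{ij} with y_P involves only e_{kl} with k < l, and these
-- kill the rest of the word on v by `pos_smul_eq_zero`.
theorem x_smul_eq_zero (h2 : (2 : F) ≠ 0) (hv : ∀ i j, i < j → a (single i j 1) • v = 0)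
    (hx : ∀ b, x b • v = 0) {L : List (Fin n × Fin n)} (hL : IsUpper L) {i j : Fin n}
    (hij : i < j) (hlt : ∀ Q ∈ L, RootLT (i, j) Q) :
    x (symmUnit F i j) • (L.map fun P => y (skewUnit F P.1 P.2)).prod • v = 0 := by
  induction L with
  | nil => simpa using hx _
  | cons P L ih =>
    have hP := hL.lt P List.mem_cons_self
    have hlt' := hlt P List.mem_cons_self
    rw [List.map_cons, List.prod_cons, ← mul_smul, ← mul_assoc, h.x_mul_y, add_mul, add_smul,
      neg_mul, neg_smul, mul_assoc, mul_smul, mul_smul,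
      ih hL.tail fun Q hQ => hlt Q (List.mem_cons_of_mem _ hQ), smul_zero, neg_zero, zero_add,
      symmUnit_mul_skewUnit, mul_smul]
    have pos : ∀ (q : Prop) [Decidable q] (k l : Fin n), (q → k < l) →
        a (if q then single k l 1 else 0) •
          (L.map fun P => y (skewUnit F P.1 P.2)).prod • v = 0 := by
      intro q _ k l hq
      split_ifs with h3
      · exact h.pos_smul_eq_zero h2 hv hL.tail (hq h3)
      · simp
    simp only [RootLT] at hlt'
    rw [map_sub, map_add, map_sub, sub_smul, add_smul, sub_smul, pos, pos, pos, pos]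
    · simp
    all_goals
      simp only [Fin.lt_def, Fin.ext_iff] at *
      omega

theorem weight_smul (hv : ∀ i, a (single i i 1) • v = μ i • v) (L : List (Fin n × Fin n))
    (i : Fin n) :
    a (single i i 1) • (L.map fun P => y (skewUnit F P.1 P.2)).prod • v =
      (μ i - (L.map fun Q => (if Q.1 = i then (1 : F) else 0) + if Q.2 = i then 1 else 0).sum) •
        (L.map fun P => y (skewUnit F P.1 P.2)).prod • v := by
  induction L with
  | nil => simpa using hv i
  | cons P L ih =>
    have e : skewAct F n (single i i 1) (skewUnit F P.1 P.2) =
        -(((if P.1 = i then (1 : F) else 0) + if P.2 = i then 1 else 0) • skewUnit F P.1 P.2) := by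
      rw [skewAct_single, add_smul, neg_add, sub_eq_add_neg]
      have e1 : (if i = P.1 then skewUnit F i P.2 else 0) =
          (if P.1 = i then (1 : F) else 0) • skewUnit F P.1 P.2 := by
        by_cases h3 : P.1 = i
        · rw [if_pos h3, if_pos h3.symm, one_smul, h3]
        · rw [if_neg h3, if_neg (Ne.symm h3), zero_smul]
      have e2 : (if i = P.2 then skewUnit F P.1 i else 0) =
          (if P.2 = i then (1 : F) else 0) • skewUnit F P.1 P.2 := by
        by_cases h3 : P.2 = i
        · rw [if_pos h3, if_pos h3.symm, one_smul, h3]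
        · rw [if_neg h3, if_neg (Ne.symm h3), zero_smul]
      rw [e1, e2]
    rw [List.map_cons, List.prod_cons, mul_smul, ← mul_smul (a _), h.a_mul_y, add_smul, mul_smul,
      ih, e, map_neg, map_smul, neg_smul, smul_assoc, List.map_cons, List.sum_cons,
      ← smul_comm (μ i - _) (y (skewUnit F P.1 P.2)), ← sub_eq_add_neg, ← sub_smul]
    congr 1
    ring

/-- The bracket of x_{ij} with y_{ij} is h_j - h_i, and the term with x_{ij} moved to the right dies
by `x_smul_eq_zero`. The scalar is the weight of the remaining word, computed by `sum_tail_weight`.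
-/
theorem step (h2 : (2 : F) ≠ 0) (hv : ∀ i j, i < j → a (single i j 1) • v = 0)
    (hx : ∀ b, x b • v = 0) (hμ : ∀ i, a (single i i 1) • v = μ i • v)
    {P : Fin n × Fin n} {L : List (Fin n × Fin n)} (hL : IsUpper (P :: L)) :
    x (symmUnit F P.1 P.2) • ((P :: L).map fun P => y (skewUnit F P.1 P.2)).prod • v =
      (-(μ P.1 - μ P.2 + ((P.2 : ℕ) : F) - ((P.1 : ℕ) : F) - 1)) •
        (L.map fun P => y (skewUnit F P.1 P.2)).prod • v := by
  obtain ⟨i, j⟩ := P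
  have hij : i < j := hL.lt _ List.mem_cons_self
  have e : (symmUnit F i j : Matrix (Fin n) (Fin n) F) *
      (skewUnit F i j : Matrix (Fin n) (Fin n) F) = single j j 1 - single i i 1 := by
    rw [symmUnit_mul_skewUnit]
    simp [hij.ne, hij.ne']
    abel
  rw [List.map_cons, List.prod_cons, mul_smul, ← mul_smul (x _), h.x_mul_y, add_smul, neg_smul,
    mul_smul, h.x_smul_eq_zero h2 hv hx hL.tail hij fun Q hQ => ((hL.mem_tail_iff Q).1 hQ).2,
    smul_zero, neg_zero, zero_add, e, map_sub, sub_smul, h.weight_smul hμ, h.weight_smul hμ,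
    ← sub_smul]
  congr 1
  linear_combination -sum_tail_weight F hij hL

theorem mem_of_list_prod_smul_mem (h2 : (2 : F) ≠ 0)
    (hv : ∀ i j, i < j → a (single i j 1) • v = 0)
    (hx : ∀ b, x b • v = 0) (hμ : ∀ i, a (single i i 1) • v = μ i • v) (hδ : delta μ ≠ 0)
    {L : List (Fin n × Fin n)} (hL : IsUpper L) {N : Submodule F K}
    (hN : ∀ b, ∀ w ∈ N, x b • w ∈ N)
    (hvN : (L.map fun P => y (skewUnit F P.1 P.2)).prod • v ∈ N) : v ∈ N := by
  induction L with
  | nil => simpa using hvN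
  | cons P L ih =>
    refine ih hL.tail ?_
    have h1 := hN (symmUnit F P.1 P.2) _ hvN
    rw [h.step h2 hv hx hμ hL] at h1
    refine (Submodule.smul_mem_iff _ (neg_ne_zero.2 ?_)).1 h1
    rw [delta, Finset.prod_ne_zero_iff] at hδ
    exact Finset.prod_ne_zero_iff.1 (hδ P.1 (Finset.mem_univ _)) P.2
      (Finset.mem_Ioi.2 (hL.lt P List.mem_cons_self))

/-- The simplicity criterion: a subspace stable under `𝔤` is zero or everything. -/
theorem eq_top_of_ne_bot (h2 : (2 : F) ≠ 0) (W : Submodule F K)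
    (ha : ∀ s, ∀ w ∈ W, a s • w ∈ W) (hx : ∀ b, ∀ w ∈ W, x b • w = 0)
    (hgen : ∀ N : Submodule F K, W ≤ N → (∀ s, ∀ w ∈ N, a s • w ∈ N) →
      (∀ b, ∀ w ∈ N, x b • w ∈ N) → (∀ c, ∀ w ∈ N, y c • w ∈ N) → N = ⊤)
    (hsimple : ∀ w ∈ W, w ≠ 0 → ∀ S : Submodule F K, (∀ s, ∀ u ∈ S, a s • u ∈ S) → w ∈ S → W ≤ S)
    (hvW : v ∈ W) (hv0 : v ≠ 0) (hv : ∀ i j, i < j → a (single i j 1) • v = 0)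
    (hμ : ∀ i, a (single i i 1) • v = μ i • v) (hδ : delta μ ≠ 0) (N : Submodule F K)
    (haN : ∀ s, ∀ w ∈ N, a s • w ∈ N) (hxN : ∀ b, ∀ w ∈ N, x b • w ∈ N)
    (hyN : ∀ c, ∀ w ∈ N, y c • w ∈ N) (hN : N ≠ ⊥) : N = ⊤ := by
  obtain ⟨L, hL, hmem⟩ := exists_isUpper n
  let Y : Fin n × Fin n → A := fun P => y (skewUnit F P.1 P.2)
  have hY : ∀ P Q, Y P * Y Q = -(Y Q * Y P) := fun _ _ => h.y_mul_y _ _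
  have hsq : ∀ P, Y P * Y P = 0 := fun _ => h.y_mul_self h2 _
  have hspan : ∀ c, y c ∈ Submodule.span F (Y '' {Q | Q ∈ L}) := by
    intro c
    have h1 := Submodule.mem_map_of_mem (f := y) (mem_span_skewUnit h2 c)
    rw [Submodule.map_span, ← Set.image_comp] at h1
    simp only [hmem]
    exact h1
  -- K = Λ(𝔤₋₁) W, obtained from generation alone.
  have htop : wordSpan Y W L = ⊤ := by
    refine h.eq_top_of_y_stable W ha hx hgen _ (le_wordSpan W L) fun c w hw => ?_
    have hc := hspan c
    generalize y c = t at hc ⊢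
    induction hc using Submodule.span_induction with
    | zero => rw [zero_smul]; exact zero_mem _
    | add u t _ _ hu ht => rw [add_smul]; exact add_mem hu ht
    | smul r u _ hu => rw [smul_assoc]; exact Submodule.smul_mem _ _ hu
    | mem u hu =>
      obtain ⟨Q, hQ, rfl⟩ := hu
      exact smul_mem_wordSpan hY hsq W hQ hw
  obtain ⟨z, hzN, hz0⟩ := Submodule.exists_mem_ne_zero_of_ne_bot hN
  obtain ⟨w, hwW, hw0, hwN⟩ := exists_list_prod_smul_mem hY hsq W L N (fun P => hyN _) hz0 hzN
    (htop ▸ Submodule.mem_top)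
  -- The subspace {u | Y_L u ∈ N} is 𝔤₀-stable because a Y_L = Y_L a + r Y_L; it contains w ≠ 0, so
  -- simplicity of `W` applies.
  have hS : W ≤ N.comap (Algebra.lsmul F F K (L.map Y).prod) := by
    refine hsimple w hwW hw0 _ (fun s u (hu : (L.map Y).prod • u ∈ N) => ?_) hwN
    change (L.map Y).prod • a s • u ∈ N
    obtain ⟨r, hr⟩ := exists_mul_list_prod_eq (F := F) hY hsq (a s) L fun P _ => by
      rw [h.a_mul_y, add_sub_cancel_left]
      exact hspan _
    rw [← mul_smul, eq_sub_of_add_eq hr.symm, sub_smul, mul_smul, smul_assoc]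
    exact sub_mem (haN s _ hu) (N.smul_mem r hu)
  have hvN : v ∈ N := h.mem_of_list_prod_smul_mem h2 hv (fun b => hx b v hvW) hμ hδ hL hxN (hS hvW)
  exact hgen N (hsimple v hvW hv0 N haN hvN) haN hxN hyN

end Relations

/-! ### Block coordinates on 𝔭(n). -/

section Coordinates

variable (F : Type*) [Field F] (n : ℕ)

/-- The inclusion of `gl(n)` in `𝔭(n)`. -/
def ofGl : Matrix (Fin n) (Fin n) F →ₗ[F] g₀ F n where
  toFun a := ⟨fromBlocks a 0 0 (-aᵀ), a, rfl⟩
  map_add' a b := Subtype.ext (by simp [fromBlocks_add, add_comm])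
  map_smul' r a := Subtype.ext (by simp [fromBlocks_smul])

/-- The upper left block. -/
def toGl : g₀ F n →ₗ[F] Matrix (Fin n) (Fin n) F where
  toFun x := (x : Mat F n).toBlocks₁₁
  map_add' _ _ := rfl
  map_smul' _ _ := rfl

/-- The inclusion of the symmetric matrices in the odd part of `𝔭(n)`. -/
def ofSymm : symm F n →ₗ[F] gOdd F n where
  toFun b := ⟨fromBlocks 0 b 0 0, b, 0, b.2, by simp, rfl⟩
  map_add' a b := Subtype.ext (by simp [fromBlocks_add])
  map_smul' r a := Subtype.ext (by simp [fromBlocks_smul])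

/-- The inclusion of the skew-symmetric matrices in the odd part of `𝔭(n)`. -/
def ofSkew : skew F n →ₗ[F] gOdd F n where
  toFun c := ⟨fromBlocks 0 0 c 0, 0, c, by simp, c.2, rfl⟩
  map_add' a b := Subtype.ext (by simp [fromBlocks_add])
  map_smul' r a := Subtype.ext (by simp [fromBlocks_smul])

/-- The upper right block. -/
def toSymm : gOdd F n →ₗ[F] symm F n where
  toFun x := ⟨(x : Mat F n).toBlocks₁₂, by
    obtain ⟨_, b, c, hb, hc, rfl⟩ := x
    exact hb⟩
  map_add' _ _ := rfl
  map_smul' _ _ := rfl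

/-- The lower left block. -/
def toSkew : gOdd F n →ₗ[F] skew F n where
  toFun x := ⟨(x : Mat F n).toBlocks₂₁, by
    obtain ⟨_, b, c, hb, hc, rfl⟩ := x
    exact hc⟩
  map_add' _ _ := rfl
  map_smul' _ _ := rfl

variable {F n}

theorem ofGl_toGl (x : g₀ F n) : ofGl F n (toGl F n x) = x := by
  obtain ⟨_, a, rfl⟩ := x
  rfl

theorem ofSymm_add_ofSkew (x : gOdd F n) :
    ofSymm F n (toSymm F n x) + ofSkew F n (toSkew F n x) = x := by
  obtain ⟨_, b, c, hb, hc, rfl⟩ := x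
  refine Subtype.ext ?_
  change fromBlocks 0 b 0 0 + fromBlocks 0 0 c 0 = fromBlocks 0 b c 0
  simp [fromBlocks_add]

theorem toGl_mul_sub (x y : g₀ F n) (h) :
    toGl F n ⟨(x : Mat F n) * y - y * x, h⟩ = toGl F n x * toGl F n y - toGl F n y * toGl F n x := by
  obtain ⟨_, a, rfl⟩ := x
  obtain ⟨_, b, rfl⟩ := y
  change toBlocks₁₁ (fromBlocks a 0 0 (-aᵀ) * fromBlocks b 0 0 (-bᵀ) -
    fromBlocks b 0 0 (-bᵀ) * fromBlocks a 0 0 (-aᵀ)) = a * b - b * a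
  simp [fromBlocks_multiply, sub_eq_add_neg, fromBlocks_neg, fromBlocks_add]

theorem toGl_pow (p : ℕ) (x : g₀ F n) (h) :
    toGl F n ⟨(x : Mat F n) ^ p, h⟩ = toGl F n x ^ p := by
  obtain ⟨_, a, rfl⟩ := x
  change toBlocks₁₁ (fromBlocks a 0 0 (-aᵀ) ^ p) = a ^ p
  rw [fromBlocks_diag_pow, toBlocks_fromBlocks₁₁]

theorem toSymm_lie (x : g₀ F n) (y : gOdd F n) (h) :
    toSymm F n ⟨(x : Mat F n) * y - y * x, h⟩ = symmAct F n (toGl F n x) (toSymm F n y) := by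
  obtain ⟨_, a, rfl⟩ := x
  obtain ⟨_, b, c, hb, hc, rfl⟩ := y
  refine Subtype.ext ?_
  change toBlocks₁₂ (fromBlocks a 0 0 (-aᵀ) * fromBlocks 0 b c 0 -
    fromBlocks 0 b c 0 * fromBlocks a 0 0 (-aᵀ)) = a * b + b * aᵀ
  simp [fromBlocks_multiply, sub_eq_add_neg, fromBlocks_neg, fromBlocks_add]

theorem toSkew_lie (x : g₀ F n) (y : gOdd F n) (h) :
    toSkew F n ⟨(x : Mat F n) * y - y * x, h⟩ = skewAct F n (toGl F n x) (toSkew F n y) := by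
  obtain ⟨_, a, rfl⟩ := x
  obtain ⟨_, b, c, hb, hc, rfl⟩ := y
  refine Subtype.ext ?_
  change toBlocks₂₁ (fromBlocks a 0 0 (-aᵀ) * fromBlocks 0 b c 0 -
    fromBlocks 0 b c 0 * fromBlocks a 0 0 (-aᵀ)) = -(aᵀ * c) - c * a
  simp [fromBlocks_multiply, sub_eq_add_neg, fromBlocks_neg, fromBlocks_add]

theorem toGl_mul_add (x y : gOdd F n) (h) :
    toGl F n ⟨(x : Mat F n) * y + y * x, h⟩ =
      (toSymm F n x : Matrix (Fin n) (Fin n) F) * (toSkew F n y : Matrix (Fin n) (Fin n) F) +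
      (toSymm F n y : Matrix (Fin n) (Fin n) F) * (toSkew F n x : Matrix (Fin n) (Fin n) F) := by
  obtain ⟨_, b, c, hb, hc, rfl⟩ := x
  obtain ⟨_, b', c', hb', hc', rfl⟩ := y
  change toBlocks₁₁ (fromBlocks 0 b c 0 * fromBlocks 0 b' c' 0 +
    fromBlocks 0 b' c' 0 * fromBlocks 0 b c 0) = b * c' + b' * c
  simp [fromBlocks_multiply, fromBlocks_add]

end Coordinates

/-! ### The model as a u_χ(𝔤)-module, and the embedding of M. -/

section Representation

variable {F : Type*} [Field F] {n : ℕ} (p : ℕ) [Fact p.Prime] [CharP F p]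
  (χ : Module.Dual F (g₀ F n))

theorem relations_red : Relations ((g F n p).ι₀ χ ∘ₗ ofGl F n) ((g F n p).ι₁ χ ∘ₗ ofSymm F n)
    ((g F n p).ι₁ χ ∘ₗ ofSkew F n) where
  a_mul_y s c := by
    have h := (g F n p).ι₀_mul_ι₁ χ (ofGl F n s) (ofSkew F n c)
    have e : (g F n p).lie₀₁ (ofGl F n s) (ofSkew F n c) = ofSkew F n (skewAct F n s c) := by
      refine Subtype.ext ?_
      change fromBlocks s 0 0 (-sᵀ) * fromBlocks 0 0 c.1 0 -
        fromBlocks 0 0 c.1 0 * fromBlocks s 0 0 (-sᵀ) = fromBlocks 0 0 (-(sᵀ * c.1) - c.1 * s) 0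
      simp [fromBlocks_multiply, sub_eq_add_neg, fromBlocks_neg, fromBlocks_add]
    rw [e, sub_eq_iff_eq_add'] at h
    exact h
  x_mul_y b c := by
    have h := (g F n p).ι₁_mul_ι₁ χ (ofSymm F n b) (ofSkew F n c)
    have e : (g F n p).lie₁₁ (ofSymm F n b) (ofSkew F n c) = ofGl F n (b * c) := by
      refine Subtype.ext ?_
      change fromBlocks 0 b.1 0 0 * fromBlocks 0 0 c.1 0 +
        fromBlocks 0 0 c.1 0 * fromBlocks 0 b.1 0 0 =
          fromBlocks (b.1 * c.1) 0 0 (-(b.1 * c.1)ᵀ)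
      simp [fromBlocks_multiply, fromBlocks_add, symm_transpose, skew_transpose]
    rw [e, ← eq_sub_iff_add_eq, sub_eq_neg_add] at h
    exact h
  y_mul_y c d := by
    have h := (g F n p).ι₁_mul_ι₁ χ (ofSkew F n c) (ofSkew F n d)
    have e : (g F n p).lie₁₁ (ofSkew F n c) (ofSkew F n d) = 0 := by
      refine Subtype.ext ?_
      change fromBlocks 0 0 c.1 0 * fromBlocks 0 0 d.1 0 +
        fromBlocks 0 0 d.1 0 * fromBlocks 0 0 c.1 0 = 0
      simp [fromBlocks_multiply]
    rw [e, map_zero] at h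
    exact eq_neg_of_add_eq_zero_left h

theorem incl_ι₀ (x : g₀ F n) :
    incl F n p χ ((gPlus F n p).ι₀ χ x) = (g F n p).ι₀ χ x :=
  lift_ι₀ ..

theorem incl_ι₁ (x : gPos F n) : incl F n p χ ((gPlus F n p).ι₁ χ x) =
    (g F n p).ι₁ χ (Submodule.inclusion (gPos_le_gOdd F n) x) :=
  lift_ι₁ ..

theorem proj_ι₀ (x : g₀ F n) :
    proj F n p χ ((gPlus F n p).ι₀ χ x) = (gZero F n p).ι₀ χ x :=
  lift_ι₀ ..

theorem proj_ι₁ (x : gPos F n) : proj F n p χ ((gPlus F n p).ι₁ χ x) = 0 :=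
  lift_ι₁ ..

variable {M K : Type*} [AddCommGroup M] [Module F M] [AddCommGroup K] [Module F K]
  [Module ((gZero F n p).Red χ) M] [IsScalarTower F ((gZero F n p).Red χ) M]
  {y : skew F n →ₗ[F] Module.End F K} {j : M →ₗ[F] K} (hK : IsModel y j)

variable (M) in
/-- The action of `gl(n)` on a `u_χ(𝔤₀)`-module. -/
def glAct : Matrix (Fin n) (Fin n) F →ₗ[F] Module.End F M :=
  (Algebra.lsmul F F M).toLinearMap ∘ₗ (gZero F n p).ι₀ χ ∘ₗ ofGl F n

theorem glAct_apply (a) (m : M) : glAct p χ M a m = (gZero F n p).ι₀ χ (ofGl F n a) • m := rfl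

theorem glAct_lie (a b) :
    glAct p χ M a * glAct p χ M b - glAct p χ M b * glAct p χ M a = glAct p χ M (a * b - b * a) := by
  have h := (gZero F n p).ι₀_mul_ι₀ χ (ofGl F n a) (ofGl F n b)
  have e : (gZero F n p).lie₀₀ (ofGl F n a) (ofGl F n b) = ofGl F n (a * b - b * a) := by
    rw [← ofGl_toGl ((gZero F n p).lie₀₀ _ _), lie₀₀, toGl_mul_sub]
    rfl
  rw [e] at h
  refine LinearMap.ext fun m => ?_
  simp only [LinearMap.sub_apply, Module.End.mul_apply, glAct_apply, ← h, sub_smul, mul_smul]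

theorem glAct_pow (a) : glAct p χ M a ^ p - glAct p χ M (a ^ p) =
    algebraMap F (Module.End F M) (χ (ofGl F n a) ^ p) := by
  have h := (gZero F n p).ι₀_pow χ (ofGl F n a)
  have e : (gZero F n p).pMap (ofGl F n a) = ofGl F n (a ^ p) := by
    rw [← ofGl_toGl ((gZero F n p).pMap _), pMap, toGl_pow]
    rfl
  rw [e] at h
  have h' := congrArg (Algebra.lsmul F F M) h
  rw [map_sub, map_pow, AlgHom.commutes] at h'
  exact h'

/-- The representation of `u_χ(𝔤)` on `Λ(𝔤₋₁) ⊗ M`. -/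
def modelRep : (g F n p).Red χ →ₐ[F] Module.End F K :=
  (g F n p).lift χ (evenOp hK (glAct p χ M) ∘ₗ toGl F n)
    (posOp hK (glAct p χ M) ∘ₗ toSymm F n + y ∘ₗ toSkew F n)
    (fun s t => by
      simp only [LinearMap.comp_apply, lie₀₀, toGl_mul_sub, evenOp_lie hK _ (glAct_lie p χ)])
    (fun s t => by
      simp only [LinearMap.comp_apply, LinearMap.add_apply, lie₀₁, toSymm_lie, toSkew_lie,
        ← evenOp_posOp hK _ (glAct_lie p χ)]
      refine LinearMap.ext fun k => ?_
      simp only [LinearMap.sub_apply, LinearMap.add_apply, Module.End.mul_apply, map_add, evenOp_y]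
      abel)
    (fun s t => by
      have h1 := LinearMap.congr_fun
        (posOp_posOp hK _ (glAct_lie p χ (M := M)) (toSymm F n s) (toSymm F n t))
      simp only [LinearMap.comp_apply, lie₁₁, toGl_mul_add]
      refine LinearMap.ext fun k => ?_
      have h2 := hK.mul_add_mul (toSkew F n s) (toSkew F n t) k
      have h3 := h1 k
      simp only [LinearMap.add_apply, LinearMap.comp_apply, Module.End.mul_apply, map_add,
        posOp_y, LinearMap.zero_apply] at h3 ⊢
      rw [eq_neg_of_add_eq_zero_left h2, eq_neg_of_add_eq_zero_left h3]
      abel)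
    (fun s => by
      simp only [LinearMap.comp_apply, pMap, toGl_pow]
      refine evenOp_pow hK _ p _ _ ?_
      rw [glAct_pow, ofGl_toGl])

theorem modelRep_ι₀ (x : g₀ F n) :
    modelRep p χ hK ((g F n p).ι₀ χ x) = evenOp hK (glAct p χ M) (toGl F n x) :=
  lift_ι₀ ..

theorem modelRep_ι₁ (x : gOdd F n) : modelRep p χ hK ((g F n p).ι₁ χ x) =
    posOp hK (glAct p χ M) (toSymm F n x) + y (toSkew F n x) :=
  lift_ι₁ ..

/-- This is the balancing condition: it lets a ⊗ m ↦ a · `j m` descend to the Kac module. -/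
theorem modelRep_incl (s : (gPlus F n p).Red χ) : ∀ m,
    modelRep p χ hK (incl F n p χ s) (j m) = j (proj F n p χ s • m) := by
  have hs : s ∈ Algebra.adjoin F
      (Set.range ((gPlus F n p).ι₀ χ) ∪ Set.range ((gPlus F n p).ι₁ χ)) := by
    rw [adjoin_range_ι]; trivial
  induction hs using Algebra.adjoin_induction with
  | mem x hx =>
    rcases hx with ⟨x, rfl⟩ | ⟨x, rfl⟩
    · intro m
      rw [incl_ι₀, proj_ι₀, modelRep_ι₀, evenOp_apply, glAct_apply, ofGl_toGl]
    · intro m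
      have hx0 : toSkew F n (Submodule.inclusion (gPos_le_gOdd F n) x) = 0 := by
        obtain ⟨_, b, hb, rfl⟩ := x
        rfl
      rw [incl_ι₁, proj_ι₁, modelRep_ι₁, hx0, map_zero, add_zero, posOp_apply, zero_smul,
        map_zero]
  | algebraMap r =>
    intro m
    rw [AlgHom.commutes, AlgHom.commutes, AlgHom.commutes, algebraMap_smul, map_smul,
      Module.algebraMap_end_apply]
  | add s t _ _ hs ht =>
    intro m
    simp only [map_add, LinearMap.add_apply, add_smul, hs, ht]
  | mul s t _ _ hs ht =>
    intro m
    simp only [map_mul, Module.End.mul_apply, mul_smul, hs, ht]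

include hK in
theorem one_tmul_not_mem_balance (hj : Function.Injective j) {m : M} (hm : m ≠ 0) :
    (1 : (g F n p).Red χ) ⊗ₜ[F] m ∉ balance F n p χ M := by
  let Ψ : (g F n p).Red χ ⊗[F] M →ₗ[F] K :=
    TensorProduct.lift ((LinearMap.lcomp F K j) ∘ₗ (modelRep p χ hK).toLinearMap)
  have hΨ : ∀ a m, Ψ (a ⊗ₜ m) = modelRep p χ hK a (j m) := fun _ _ => rfl
  have hsmul : ∀ (a : (g F n p).Red χ) t, Ψ (a • t) = modelRep p χ hK a (Ψ t) := by
    intro a t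
    induction t with
    | zero => simp
    | tmul b m => rw [TensorProduct.smul_tmul', hΨ, hΨ, smul_eq_mul, map_mul, Module.End.mul_apply]
    | add s t hs ht => rw [smul_add, map_add, hs, ht, map_add, map_add]
  have hker : ∀ t ∈ balance F n p χ M, Ψ t = 0 := by
    intro t ht
    induction ht using Submodule.span_induction with
    | zero => exact map_zero _
    | add s t _ _ hs ht => rw [map_add, hs, ht, add_zero]
    | smul a t _ ht => rw [hsmul, ht, map_zero]
    | mem t ht =>
      obtain ⟨a, s, m, rfl⟩ := ht
      rw [map_sub, hΨ, hΨ, map_mul, Module.End.mul_apply, modelRep_incl, sub_self]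
  intro h
  have := hker _ h
  rw [hΨ, map_one, Module.End.one_apply] at this
  exact hm (hj (this.trans (map_zero j).symm))

end Representation

/-! ### The Kac module and the image of M in it. -/

section Kac

variable {F : Type*} [Field F] {n : ℕ} (p : ℕ) [Fact p.Prime] [CharP F p]
  (χ : Module.Dual F (g₀ F n)) (M : Type*) [AddCommGroup M] [Module F M]
  [Module ((gZero F n p).Red χ) M]

/-- The canonical map from `M` to its Kac module. -/
def kacι : M →ₗ[F] KacModule F n p χ M :=
  (balance F n p χ M).mkQ.restrictScalars F ∘ₗ TensorProduct.mk F ((g F n p).Red χ) M 1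

variable {M}

theorem kacι_proj_smul (s : (gPlus F n p).Red χ) (m : M) :
    kacι p χ M (proj F n p χ s • m) = incl F n p χ s • kacι p χ M m := by
  have h : (1 * incl F n p χ s) ⊗ₜ[F] m - 1 ⊗ₜ[F] (proj F n p χ s • m) ∈ balance F n p χ M :=
    Submodule.subset_span ⟨1, s, m, rfl⟩
  have h' := ((Submodule.Quotient.eq _).2 h).symm
  rw [one_mul, ← mul_one (incl F n p χ s), ← smul_eq_mul, ← TensorProduct.smul_tmul'] at h'
  exact h'

theorem kacι_ι₀_smul (x : g₀ F n) (m : M) :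
    kacι p χ M ((gZero F n p).ι₀ χ x • m) = (g F n p).ι₀ χ x • kacι p χ M m := by
  have h := kacι_proj_smul p χ ((gPlus F n p).ι₀ χ x) m
  rwa [proj_ι₀, incl_ι₀] at h

theorem ι₁_ofSymm_smul_kacι (b : symm F n) (m : M) :
    (g F n p).ι₁ χ (ofSymm F n b) • kacι p χ M m = 0 := by
  let x : gPos F n := ⟨fromBlocks 0 b 0 0, b, b.2, rfl⟩
  have h := kacι_proj_smul p χ ((gPlus F n p).ι₁ χ x) m
  rw [proj_ι₁, incl_ι₁, zero_smul, map_zero] at h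
  exact h.symm

theorem kac_eq_top (N : Submodule F (KacModule F n p χ M))
    (hN : ∀ (u : (g F n p).Red χ), ∀ w ∈ N, u • w ∈ N)
    (hMN : LinearMap.range (kacι p χ M) ≤ N) : N = ⊤ := by
  refine Submodule.eq_top_iff'.2 fun t => ?_
  obtain ⟨t, rfl⟩ := Submodule.Quotient.mk_surjective _ t
  induction t with
  | zero => exact zero_mem N
  | add s t hs ht => exact add_mem hs ht
  | tmul a m =>
    have h := hN a _ (hMN ⟨m, rfl⟩)
    have e : a • kacι p χ M m = Submodule.Quotient.mk (a ⊗ₜ[F] m) := by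
      change a • Submodule.Quotient.mk ((1 : (g F n p).Red χ) ⊗ₜ[F] m) = _
      rw [← Submodule.Quotient.mk_smul, TensorProduct.smul_tmul', smul_eq_mul, mul_one]
    rwa [e] at h

theorem smul_mem_of_coordinates {K : Type*} [AddCommGroup K] [Module F K]
    [Module ((g F n p).Red χ) K] [IsScalarTower F ((g F n p).Red χ) K] (N : Submodule F K)
    (ha : ∀ s, ∀ w ∈ N, ((g F n p).ι₀ χ ∘ₗ ofGl F n) s • w ∈ N)
    (hx : ∀ s, ∀ w ∈ N, ((g F n p).ι₁ χ ∘ₗ ofSymm F n) s • w ∈ N)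
    (hy : ∀ s, ∀ w ∈ N, ((g F n p).ι₁ χ ∘ₗ ofSkew F n) s • w ∈ N) (u : (g F n p).Red χ) :
    ∀ w ∈ N, u • w ∈ N := by
  refine (g F n p).smul_mem_of_stable χ N (fun s w hw => ?_) (fun s w hw => ?_) u
  · have := ha (toGl F n s) w hw
    rwa [LinearMap.comp_apply, ofGl_toGl] at this
  · rw [← ofSymm_add_ofSkew s, map_add, add_smul]
    exact add_mem (hx _ w hw) (hy _ w hw)

end Kac

end Periplectic

end

open Periplectic

theorem proposition2p3 {F : Type*} [Field F] [IsAlgClosed F] (p : ℕ) [Fact p.Prime] [CharP F p]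
    (hp : 2 < p) (n : ℕ) (hn : 2 ≤ n)
    (χ : Module.Dual F (Periplectic.g₀ F n)) (hχ : ∀ x ∈ Periplectic.nPlus F n, χ x = 0)
    {M : Type*} [AddCommGroup M] [Module F M] [Module ((Periplectic.gZero F n p).Red χ) M]
    [IsScalarTower F ((Periplectic.gZero F n p).Red χ) M]
    (hM : IsSimpleModule ((Periplectic.gZero F n p).Red χ) M)
    (μ : Fin n → F) (v : M) (hv : Periplectic.IsMaximalVector p χ v μ)
    (hgen : Submodule.span ((Periplectic.gZero F n p).Red χ) {v} = ⊤)
    (hδ : Periplectic.delta μ ≠ 0) :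
    IsSimpleModule ((Periplectic.g F n p).Red χ) (Periplectic.KacModule F n p χ M) := by
  have h2 : (2 : F) ≠ 0 := by
    have h : ((2 : ℕ) : F) ≠ 0 := fun h =>
      absurd (Nat.le_of_dvd two_pos ((CharP.cast_eq_zero_iff F p 2).1 h)) (by omega)
    exact_mod_cast h
  obtain ⟨hv0, hvpos, hvμ⟩ := hv
  have hinj : ∀ m : M, kacι p χ M m = 0 → m = 0 := by
    intro m hm
    by_contra hm0
    exact one_tmul_not_mem_balance p χ ExteriorAlgebra.isModel_wedge
      (ExteriorAlgebra.one_tmul_injective F (skew F n) M) hm0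
      ((Submodule.Quotient.mk_eq_zero _).1 hm)
  have hkv : kacι p χ M v ≠ 0 := fun h => hv0 (hinj v h)
  have : Nontrivial (KacModule F n p χ M) := ⟨⟨_, 0, hkv⟩⟩
  refine { eq_bot_or_eq_top := fun N => or_iff_not_imp_left.2 fun hN => ?_ }
  have hN' : N.restrictScalars F ≠ ⊥ := fun h => hN ((Submodule.restrictScalars_eq_bot_iff ..).1 h)
  refine (Submodule.restrictScalars_eq_top_iff F _ _).1 ?_
  -- The criterion is applied with `W` the image of M in the Kac module.
  refine (relations_red p χ).eq_top_of_ne_bot (v := kacι p χ M v) h2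
    (LinearMap.range (kacι p χ M)) ?_ ?_ ?_ ?_ ⟨v, rfl⟩ hkv ?_ ?_ hδ _ (fun s w hw => N.smul_mem _ hw)
    (fun s w hw => N.smul_mem _ hw) (fun s w hw => N.smul_mem _ hw) hN'
  · rintro s _ ⟨m, rfl⟩
    exact ⟨_, kacι_ι₀_smul p χ _ m⟩
  · rintro b _ ⟨m, rfl⟩
    exact ι₁_ofSymm_smul_kacι p χ b m
  · intro N hMN ha hx hy
    exact kac_eq_top p χ N (smul_mem_of_coordinates p χ N ha hx hy) hMN
  · rintro _ ⟨m, rfl⟩ hm S hS hmS _ ⟨m', rfl⟩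
    -- The preimage of `S` in M is 𝔤₀-stable, hence a u_χ(𝔤₀)-submodule, so simplicity of M makes it
    -- everything.
    let T : Submodule ((gZero F n p).Red χ) M :=
      { (S.comap (kacι p χ M)).toAddSubmonoid with
        smul_mem' := fun u w hw =>
          (gZero F n p).smul_mem_of_stable χ (S.comap (kacι p χ M))
            (fun s w (hw : kacι p χ M w ∈ S) => by
              have h := hS (toGl F n s) _ hw
              rwa [LinearMap.comp_apply, ofGl_toGl, ← kacι_ι₀_smul] at h)
            (fun s w _ => by
              have hs : s = 0 := Subtype.ext ((Submodule.mem_bot F).1 s.2)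
              rw [hs, map_zero, zero_smul]
              exact zero_mem _) u w hw }
    have hT : T ≠ ⊥ := fun h => hm (by
      have h1 : m ∈ T := hmS
      rw [h, Submodule.mem_bot] at h1
      rw [h1, map_zero])
    have h1 : m' ∈ T := by
      rw [(eq_bot_or_eq_top T).resolve_left hT]
      trivial
    exact h1
  · intro i j hij
    have h := hvpos (e F i j) (Submodule.subset_span ⟨i, j, hij, rfl⟩)
    have h1 := kacι_ι₀_smul p χ (e F i j) v
    rw [h, map_zero] at h1
    exact h1.symm
  · intro i
    have h1 := kacι_ι₀_smul p χ (e F i i) v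
    rw [hvμ, map_smul] at h1
    exact h1.symm
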